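/- **Theorem 4.1** (variational criterion for Sobolev jets). For $m\in\mathbb N=\{1,2,\dots\}$ and $p\in(1,\infty)$ let $L^m_p(\mathbb R)$ be the homogeneous Sobolev space of all functions $F:\mathbb R\to\mathbb R$ of class $C^{m-1}$ such that $F^{(m-1)}$ is absolutely continuous on every compact interval and the weak $m$-th derivative $F^{(m)}$ belongs to $L_p(\mathbb R)$, with the seminorm $\|F\|_{L^m_p(\mathbb R)}=\|F^{(m)}\|_{L_p(\mathbb R)}$. For a $C^{m-1}$-function $F$ let $T^{m-1}_x[F](y)=\sum_{k=0}^{m-1}\frac1{k!}F^{(k)}(x)(y-x)^k$. Let $m\in\mathbb N$, $p\in(1,\infty)$, let $E\subset\mathbb R$ be a closed set, and let $\mathbf P=\{P_x:x\in E\}$ be a family of real polynomials of degree at most $m-1$ indexed by the points of $E$. There exists a $C^{m-1}$-function $F\in L^m_p(\mathbb R)$ such that $T^{m-1}_x[F]=P_x$ for every $x\in E$ if and only if the quantity $$\mathcal N_{m,p,E}(\mathbf P)=\sup\left\{\sum_{j=1}^{k-1}\sum_{i=0}^{m-1}\frac{|P^{(i)}_{x_j}(x_j)-P^{(i)}_{x_{j+1}}(x_j)|^p}{(x_{j+1}-x_j)^{(m-i)p-1}}\right\}^{1/p}$$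 is finite, where the supremum is taken over all integers $k>1$ and all strictly increasing sequences $x_1<\dots<x_k$ of points of $E$ (it is $0$ if there are none). Furthermore, put $$\|\mathbf P\|_{m,p,E}=\inf\left\{\|F\|_{L^m_p(\mathbb R)}:F\in L^m_p(\mathbb R),\ T^{m-1}_x[F]=P_x\text{ for every }x\in E\right\}\in[0,\infty],$$ with $\inf\emptyset=\infty$. Then there is a constant $C\ge1$ depending only on $m$ such that $$C^{-1}\,\mathcal N_{m,p,E}(\mathbf P)\le\|\mathbf P\|_{m,p,E}\le C\,\mathcal N_{m,p,E}(\mathbf P).$$ -/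

import Mathlib

open MeasureTheory Polynomial
open scoped ENNReal NNReal Nat

/-- `g` is a weak `k`-th derivative of `F` on the real line: both are locally integrable and
`∫ F ψ⁽ᵏ⁾ = (-1)ᵏ ∫ g ψ` for every smooth compactly supported test function `ψ`. -/
def IsWeakDeriv (k : ℕ) (F g : ℝ → ℝ) : Prop :=
  LocallyIntegrable F volume ∧ LocallyIntegrable g volume ∧
    ∀ ψ : ℝ → ℝ, ContDiff ℝ ((⊤ : ℕ∞) : WithTop ℕ∞) ψ → HasCompactSupport ψ →
      ∫ t, F t * iteratedDeriv k ψ t = (-1) ^ k * ∫ t, g t * ψ t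

/-- Membership in the homogeneous Sobolev space `L^m_p(ℝ)` (for `m ≥ 1`): `F` is of class
`C^{m-1}`, its derivative of order `m - 1` is absolutely continuous (on every compact interval),
and `F` has a weak `m`-th derivative that lies in `L_p(ℝ)`. -/
structure MemSobolevL (m : ℕ) (p : ℝ) (F : ℝ → ℝ) : Prop where
  contDiff : ContDiff ℝ ((m - 1 : ℕ) : WithTop ℕ∞) F
  absolutelyContinuous :
    ∀ a b : ℝ, AbsolutelyContinuousOnInterval (iteratedDeriv (m - 1) F) a b
  exists_weakDeriv : ∃ g : ℝ → ℝ, IsWeakDeriv m F g ∧ MemLp g (ENNReal.ofReal p) volume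

/-- The seminorm `‖F‖ = ‖F⁽ᵐ⁾‖_{L_p(ℝ)}`, where `F⁽ᵐ⁾` is the weak `m`-th derivative. The weak
derivative is unique up to null sets, so the infimum is over functions with one and the same
`L_p`-norm; it is `∞` if there is no weak derivative. -/
noncomputable def sobolevLSeminorm (m : ℕ) (p : ℝ) (F : ℝ → ℝ) : ℝ≥0∞ :=
  ⨅ (g : ℝ → ℝ) (_ : IsWeakDeriv m F g), eLpNorm g (ENNReal.ofReal p) volume

/-- The Taylor polynomial `∑_{k ≤ n} F⁽ᵏ⁾(x) / k! (y - x)ᵏ` of degree `n` of `F` at `x`. -/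
noncomputable def taylorJet (n : ℕ) (F : ℝ → ℝ) (x : ℝ) : ℝ[X] :=
  ∑ k ∈ Finset.range (n + 1), C (iteratedDeriv k F x / (k ! : ℝ)) * (X - C x) ^ k

/-- The norm of the jet `P = {P_x : x ∈ E}`: the infimum of the seminorms of all functions
`F ∈ L^m_p(ℝ)` whose Taylor polynomial of degree `m - 1` at `x` is `P_x`, for every `x ∈ E`
(it is `∞` if there is no such `F`). -/
noncomputable def jetNorm (m : ℕ) (p : ℝ) (E : Set ℝ) (P : E → ℝ[X]) : ℝ≥0∞ :=
  ⨅ (F : ℝ → ℝ) (_ : MemSobolevL m p F) (_ : ∀ x : E, taylorJet (m - 1) F (x : ℝ) = P x),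
    sobolevLSeminorm m p F

/-- The sum over `j` and over `0 ≤ i ≤ m - 1` of
`|P_{x_j}⁽ⁱ⁾(x_j) - P_{x_{j+1}}⁽ⁱ⁾(x_j)|^p / (x_{j+1} - x_j)^{(m-i)p-1}` for a finite sequence
`x` of `n + 2 ≥ 2` points of `E`. -/
noncomputable def jetVariationSum (m : ℕ) (p : ℝ) (E : Set ℝ) (P : E → ℝ[X])
    (n : ℕ) (x : Fin (n + 2) → E) : ℝ :=
  ∑ j : Fin (n + 1), ∑ i ∈ Finset.range m,
    |(derivative^[i] (P (x j.castSucc))).eval (x j.castSucc : ℝ) -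
        (derivative^[i] (P (x j.succ))).eval (x j.castSucc : ℝ)| ^ p /
      ((x j.succ : ℝ) - (x j.castSucc : ℝ)) ^ (((m : ℝ) - (i : ℝ)) * p - 1)

/-- The variational quantity of the field `P`: the supremum of the sums above over all strictly
increasing finite sequences of at least two points of `E`, to the power `1 / p`. -/
noncomputable def jetVariation (m : ℕ) (p : ℝ) (E : Set ℝ) (P : E → ℝ[X]) : ℝ≥0∞ :=
  (⨆ (n : ℕ) (x : Fin (n + 2) → E) (_ : StrictMono x),
    ENNReal.ofReal (jetVariationSum m p E P n x)) ^ (1 / p)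

/-!
Everything is expressed through one kind of control. Let `Ω` be a monotone function and put
`κ(x, y) = (Ω y - Ω x) ^ (1 / p) (y - x) ^ (1 - 1 / p)` (`geomIncrement`). The summand of the
variation at `x < y` and order `i` is at most `Ω y - Ω x` if and only if the derivatives of order
`i` of `P_x` and `P_y` differ at `x` by at most `κ(x, y) (y - x) ^ (m - 1 - i)`
(`rpow_div_rpow_le_iff`); this compatibility of two jets is `JetClose`. By Hölder's inequality `κ`
is superadditive (`geomIncrement_add_le`), and the compatibility of jets is transitive with
additive constants (`JetClose.trans`), because a bound on the jet of a polynomial of degree less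
than `m` at one point propagates to other points without loss (`abs_eval_iterate_derivative_le`).
Hence compatibility with a fixed multiple of `κ` is a transitive relation, and a chain of points
costs nothing.

*The variation bounds the norm from below.* For a Sobolev function the top derivative is absolutely
continuous and its almost everywhere derivative is the weak derivative, so that Taylor's formula
and Hölder's inequality give the compatibility with `Ω x = ∫_{-∞}^x |F⁽ᵐ⁾|^p`; the increments of
`Ω` telescope along a sequence (`jetVariation_le_eLpNorm`).

*A field of finite variation extends.* On `E` let `Ω x` be the supremum of the variation sums over
sequences that end at `x`; then consecutive summands are dominated by increments of `Ω`
(`jetVariationUpTo_add_le`). Over a bounded complementary interval `(a, b)` the jets `P_a`, `P_b`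
are joined by the polynomial `P_b + θ ((X - a) / (b - a)) (P_a - P_b)`, where `θ` is a fixed
polynomial that is `1` to order `m` at `0` and `0` to order `m` at `1`, and `Ω` is interpolated
linearly. The derivative of order `m` of this polynomial is at most a constant times
`κ(a, b) / (b - a)`, which is the compatibility inside the interval, and transitivity gives it on
the whole line (`exists_jet_field_extension`). A field of jets on the line with this property is
the field of jets of a function `F` of class `C^{m-1}`, because the error terms have order greater
than one (`hasDerivAt_of_jetClose`). Its top derivative `f` satisfies `|f x - f y| ≤ c κ(x, y)`;
therefore it is absolutely continuous, `|f'|^p ≤ c^p Ω'` almost everywhere, and the integral of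
`Ω'` is at most the total increase of `Ω` (`eLpNorm_deriv_le_of_le_geomIncrement`).
-/

/-! ### Chains of derivatives, and the geometric mean of two increments -/

/-- Integration of a bound down a chain `u 0, u 1, …, u n` of successive derivatives: if `u n` is
bounded by `K` and the values of the lower members at `y` are at most `K η ^ (n - i)`, then the
members at `t` are at most `K (η + |t - y|) ^ (n - i)`. -/
theorem abs_le_of_hasDerivAt_chain {u : ℕ → ℝ → ℝ} {n : ℕ} {a b y K η : ℝ} (hη : 0 ≤ η)
    (hy : y ∈ Set.Icc a b)
    (hu : ∀ i < n, ∀ t ∈ Set.Icc a b, HasDerivAt (u i) (u (i + 1) t) t)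
    (hn : ∀ t ∈ Set.Icc a b, |u n t| ≤ K) (hi : ∀ i < n, |u i y| ≤ K * η ^ (n - i))
    {i : ℕ} (hin : i ≤ n) {t : ℝ} (ht : t ∈ Set.Icc a b) :
    |u i t| ≤ K * (η + |t - y|) ^ (n - i) := by
  have hK : 0 ≤ K := (abs_nonneg _).trans (hn y hy)
  obtain ⟨k, rfl⟩ := Nat.exists_eq_add_of_le hin
  induction k generalizing i t with
  | zero => simpa using hn t ht
  | succ k ih =>
    have hsub : Set.uIcc y t ⊆ Set.Icc a b := Set.ordConnected_Icc.uIcc_subset hy ht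
    have hmv : ‖u i t - u i y‖ ≤ K * (η + |t - y|) ^ k * ‖t - y‖ := by
      refine (convex_uIcc y t).norm_image_sub_le_of_norm_hasDerivWithin_le
        (f' := u (i + 1)) (fun s hs => (hu i (by omega) s (hsub hs)).hasDerivWithinAt)
        (fun s hs => ?_) Set.left_mem_uIcc Set.right_mem_uIcc
      have e : i + (k + 1) = i + 1 + k := by omega
      have := ih (i := i + 1) (t := s) (hsub hs) (by rwa [← e]) (by rwa [← e]) (by rwa [← e])
        (by omega)
      refine this.trans ?_
      rw [show i + 1 + k - (i + 1) = k by omega]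
      have hst : |s - y| ≤ |t - y| := by
        exact Set.abs_sub_left_of_mem_uIcc hs
      gcongr
    have h0 := hi i (by omega)
    rw [show i + (k + 1) - i = k + 1 by omega] at h0 ⊢
    rw [Real.norm_eq_abs, Real.norm_eq_abs] at hmv
    have hd := abs_nonneg (t - y)
    have hpow : η ^ k ≤ (η + |t - y|) ^ k := by gcongr; linarith
    calc |u i t| = |u i y + (u i t - u i y)| := by ring_nf
      _ ≤ |u i y| + |u i t - u i y| := abs_add_le _ _
      _ ≤ K * η ^ (k + 1) + K * (η + |t - y|) ^ k * |t - y| := add_le_add h0 hmv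
      _ ≤ K * (η * (η + |t - y|) ^ k) + K * (η + |t - y|) ^ k * |t - y| := by
          rw [pow_succ']; gcongr
      _ = K * (η + |t - y|) ^ (k + 1) := by ring

/-- Hölder's inequality for sums of weighted geometric means. -/
theorem sum_rpow_mul_rpow_le {ι : Type*} (s : Finset ι) {p : ℝ} (hp : 1 < p) {a c : ι → ℝ}
    (ha : ∀ i ∈ s, 0 ≤ a i) (hc : ∀ i ∈ s, 0 ≤ c i) :
    ∑ i ∈ s, a i ^ (1 / p) * c i ^ (1 - 1 / p) ≤
      (∑ i ∈ s, a i) ^ (1 / p) * (∑ i ∈ s, c i) ^ (1 - 1 / p) := by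
  have hpq := Real.HolderConjugate.conjExponent hp
  have hq : 1 - 1 / p = 1 / p.conjExponent := by
    have := hpq.inv_add_inv_eq_one
    simp only [one_div]; linarith
  have hp0 : p ≠ 0 := by positivity
  have hq0 : p.conjExponent ≠ 0 := hpq.symm.ne_zero
  rw [hq]
  have := Real.inner_le_Lp_mul_Lq_of_nonneg s hpq (f := fun i => a i ^ (1 / p))
    (g := fun i => c i ^ (1 / p.conjExponent)) (fun i hi => Real.rpow_nonneg (ha i hi) _)
    (fun i hi => Real.rpow_nonneg (hc i hi) _)
  refine this.trans_eq ?_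
  congr 2
  · refine Finset.sum_congr rfl fun i hi => ?_
    rw [← Real.rpow_mul (ha i hi), one_div, inv_mul_cancel₀ hp0, Real.rpow_one]
  · refine Finset.sum_congr rfl fun i hi => ?_
    rw [← Real.rpow_mul (hc i hi), one_div, inv_mul_cancel₀ hq0, Real.rpow_one]

/-- The weighted geometric mean `(Ω y - Ω x) ^ (1 / p) (y - x) ^ (1 - 1 / p)` of the increment of
`Ω` and the length of the interval. -/
noncomputable def geomIncrement (p : ℝ) (Ω : ℝ → ℝ) (x y : ℝ) : ℝ :=
  (Ω y - Ω x) ^ (1 / p) * (y - x) ^ (1 - 1 / p)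

theorem geomIncrement_nonneg {p : ℝ} {Ω : ℝ → ℝ} {x y : ℝ} (hΩ : Ω x ≤ Ω y) (h : x ≤ y) :
    0 ≤ geomIncrement p Ω x y :=
  mul_nonneg (Real.rpow_nonneg (sub_nonneg.2 hΩ) _) (Real.rpow_nonneg (sub_nonneg.2 h) _)

theorem geomIncrement_add_le {p : ℝ} (hp : 1 < p) {Ω : ℝ → ℝ} {x y z : ℝ} (hxy : x ≤ y)
    (hyz : y ≤ z) (hΩxy : Ω x ≤ Ω y) (hΩyz : Ω y ≤ Ω z) :
    geomIncrement p Ω x y + geomIncrement p Ω y z ≤ geomIncrement p Ω x z := by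
  have := sum_rpow_mul_rpow_le (Finset.univ : Finset (Fin 2)) hp
    (a := ![Ω y - Ω x, Ω z - Ω y]) (c := ![y - x, z - y])
    (by intro i _; fin_cases i <;> simp [*]) (by intro i _; fin_cases i <;> simp [*])
  simp only [Fin.sum_univ_two, Matrix.cons_val_zero, Matrix.cons_val_one] at this
  rw [show Ω y - Ω x + (Ω z - Ω y) = Ω z - Ω x by ring, show y - x + (z - y) = z - x by ring]
    at this
  exact this

/-- The geometric mean is exactly what a summand of the variation controls. -/
theorem rpow_div_rpow_le_iff {p : ℝ} (hp : 1 < p) {m i : ℕ} (hi : i < m) {a h W : ℝ}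
    (ha : 0 ≤ a) (hh : 0 < h) (hW : 0 ≤ W) :
    a ^ p / h ^ (((m : ℝ) - (i : ℝ)) * p - 1) ≤ W ↔
      a ≤ W ^ (1 / p) * h ^ (1 - 1 / p) * h ^ (m - 1 - i) := by
  have hp0 : 0 < p := by linarith
  have key : W ^ (1 / p) * h ^ (1 - 1 / p) * h ^ (m - 1 - i) =
      (W * h ^ (((m : ℝ) - (i : ℝ)) * p - 1)) ^ (1 / p) := by
    rw [Real.mul_rpow hW (Real.rpow_nonneg hh.le _), ← Real.rpow_mul hh.le, mul_assoc,
      ← Real.rpow_natCast, ← Real.rpow_add hh]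
    congr 2
    rw [show m - 1 - i = m - (i + 1) by omega, Nat.cast_sub (by omega)]
    push_cast
    field_simp
    ring
  rw [div_le_iff₀ (Real.rpow_pos_of_pos hh _), key]
  rw [Real.le_rpow_inv_iff_of_pos ha (mul_nonneg hW (Real.rpow_nonneg hh.le _)) hp0 |>.symm,
    one_div]

/-! ### Jets of polynomials -/

theorem hasDerivAt_eval_iterate_derivative (R : ℝ[X]) (i : ℕ) (t : ℝ) :
    HasDerivAt (fun s => (derivative^[i] R).eval s) ((derivative^[i + 1] R).eval t) t := by
  rw [Function.iterate_succ_apply']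
  exact (derivative^[i] R).hasDerivAt t

theorem eval_iterate_derivative_pred_eq {m : ℕ} {R : ℝ[X]} (hR : R.natDegree < m) (s y : ℝ) :
    (derivative^[m - 1] R).eval s = (derivative^[m - 1] R).eval y := by
  have hz : derivative (derivative^[m - 1] R) = 0 := by
    rw [← Function.iterate_succ_apply' derivative]
    exact iterate_derivative_eq_zero (by omega)
  rw [eq_C_of_derivative_eq_zero hz]
  simp

/-- A bound on the jet of a polynomial of degree less than `m` at `y`, transported to `t`. -/
theorem abs_eval_iterate_derivative_le {m : ℕ} {R : ℝ[X]} (hR : R.natDegree < m)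
    {y t K η : ℝ} (hη : 0 ≤ η)
    (h : ∀ i < m, |(derivative^[i] R).eval y| ≤ K * η ^ (m - 1 - i)) {i : ℕ} (hi : i < m) :
    |(derivative^[i] R).eval t| ≤ K * (η + |t - y|) ^ (m - 1 - i) := by
  refine abs_le_of_hasDerivAt_chain (u := fun i s => (derivative^[i] R).eval s) (n := m - 1)
    (a := min y t) (b := max y t) hη ⟨min_le_left _ _, le_max_left _ _⟩
    (fun i _ s _ => hasDerivAt_eval_iterate_derivative R i s) (fun s _ => ?_)
    (fun j hj => h j (by omega)) (by omega) ⟨min_le_right _ _, le_max_right _ _⟩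
  simp only [eval_iterate_derivative_pred_eq hR s y]
  simpa using h (m - 1) (by omega)

/-- The jets of order `m - 1` of `A` at `x` and of `B` at `y > x` are compatible with constant
`K`: the two polynomials are compared at `x`, each derivative at its natural scale. -/
def JetClose (m : ℕ) (A B : ℝ[X]) (K x y : ℝ) : Prop :=
  ∀ i < m, |(derivative^[i] (A - B)).eval x| ≤ K * (y - x) ^ (m - 1 - i)

namespace JetClose

variable {m : ℕ} {A B D : ℝ[X]} {K K' x y z : ℝ}

theorem refl (m : ℕ) (A : ℝ[X]) (hK : 0 ≤ K) (h : x ≤ y) : JetClose m A A K x y := by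
  intro i _
  have := sub_nonneg.2 h
  simp only [sub_self, iterate_map_zero, eval_zero, abs_zero]
  positivity

theorem mono (h : JetClose m A B K x y) (hK : K ≤ K') (hxy : x ≤ y) : JetClose m A B K' x y :=
  fun i hi => (h i hi).trans
    (mul_le_mul_of_nonneg_right hK (pow_nonneg (sub_nonneg.2 hxy) _))

theorem abs_eval_le (h : JetClose m A B K x y) (hxy : x ≤ y) (hAB : (A - B).natDegree < m)
    (t : ℝ) {i : ℕ} (hi : i < m) :
    |(derivative^[i] (A - B)).eval t| ≤ K * (y - x + |t - x|) ^ (m - 1 - i) :=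
  abs_eval_iterate_derivative_le hAB (sub_nonneg.2 hxy) h hi

/-- Compatibility is transitive, and the constants simply add up. -/
theorem trans (h : JetClose m A B K x y) (h' : JetClose m B D K' y z) (hxy : x ≤ y) (hyz : y ≤ z)
    (hK : 0 ≤ K) (hBD : (B - D).natDegree < m) : JetClose m A D (K + K') x z := by
  intro i hi
  have h2 := h'.abs_eval_le hyz hBD x hi
  rw [abs_sub_comm, abs_of_nonneg (sub_nonneg.2 hxy), sub_add_sub_cancel] at h2
  have h1 : K * (y - x) ^ (m - 1 - i) ≤ K * (z - x) ^ (m - 1 - i) := by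
    have := sub_nonneg.2 hxy
    gcongr
  rw [← sub_add_sub_cancel A B D, iterate_map_add, eval_add]
  calc _ ≤ _ := abs_add_le _ _
    _ ≤ K * (z - x) ^ (m - 1 - i) + K' * (z - x) ^ (m - 1 - i) :=
      add_le_add ((h i hi).trans h1) h2
    _ = _ := by ring

end JetClose

theorem eval_iterate_derivative_eq_zero_of_pow_dvd {m i : ℕ} (hi : i < m) {y : ℝ} {G : ℝ[X]}
    (h : (X - C y) ^ m ∣ G) : (derivative^[i] G).eval y = 0 := by
  have h1 : (X - C y) ^ (m - i) ∣ derivative^[i] G := pow_sub_dvd_iterate_derivative_of_pow_dvd i h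
  exact dvd_iff_isRoot.1 ((dvd_pow_self _ (by omega)).trans h1)

theorem pow_dvd_sub_modByMonic (m : ℕ) (y : ℝ) (H : ℝ[X]) :
    (X - C y) ^ m ∣ H - H %ₘ (X - C y) ^ m :=
  ⟨H /ₘ (X - C y) ^ m, by linear_combination -(modByMonic_add_div H ((X - C y) ^ m))⟩

/-- The remainder modulo `(X - y) ^ m` is the Taylor polynomial of order `m - 1` at `y`. -/
theorem eval_iterate_derivative_modByMonic {m i : ℕ} (hi : i < m) (y : ℝ) (H : ℝ[X]) :
    (derivative^[i] (H %ₘ (X - C y) ^ m)).eval y = (derivative^[i] H).eval y := by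
  have := eval_iterate_derivative_eq_zero_of_pow_dvd hi (pow_dvd_sub_modByMonic m y H)
  rw [iterate_derivative_sub, eval_sub] at this
  linarith

theorem natDegree_modByMonic_X_sub_C_pow_lt {m : ℕ} (hm : 1 ≤ m) (y : ℝ) (H : ℝ[X]) :
    (H %ₘ (X - C y) ^ m).natDegree < m := by
  have h := natDegree_modByMonic_lt H ((monic_X_sub_C y).pow m) (by
    intro h
    have := congrArg natDegree h
    rw [natDegree_pow, natDegree_X_sub_C, natDegree_one] at this
    omega)
  rwa [natDegree_pow, natDegree_X_sub_C, mul_one] at h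

theorem modByMonic_X_sub_C_pow_eq_of_dvd {m : ℕ} {y : ℝ} {H A : ℝ[X]}
    (hA : A.natDegree < m) (h : (X - C y) ^ m ∣ H - A) : H %ₘ (X - C y) ^ m = A := by
  have hmon := (monic_X_sub_C y).pow m
  have h0 : (H - A) %ₘ (X - C y) ^ m = 0 := (modByMonic_eq_zero_iff_dvd hmon).2 h
  rw [sub_modByMonic, sub_eq_zero] at h0
  rw [h0, modByMonic_eq_self_iff hmon, degree_eq_natDegree hmon.ne_zero, natDegree_pow,
    natDegree_X_sub_C, mul_one]
  exact degree_le_natDegree.trans_lt (by exact_mod_cast hA)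

/-- Two Taylor polynomials of one polynomial `H` are compatible, with the constant given by the
derivative of order `m` of `H`. -/
theorem jetClose_modByMonic {m : ℕ} (hm : 1 ≤ m) {H : ℝ[X]} {x y M : ℝ} (hxy : x ≤ y)
    (hM : ∀ t ∈ Set.Icc x y, |(derivative^[m] H).eval t| ≤ M) :
    JetClose m (H %ₘ (X - C x) ^ m) (H %ₘ (X - C y) ^ m) (M * (y - x)) x y := by
  intro i hi
  set G := H - H %ₘ (X - C y) ^ m with hG
  have hGm : derivative^[m] G = derivative^[m] H := by
    rw [hG, iterate_derivative_sub,
      iterate_derivative_eq_zero (natDegree_modByMonic_X_sub_C_pow_lt hm y H), sub_zero]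
  have key := abs_le_of_hasDerivAt_chain (u := fun i s => (derivative^[i] G).eval s) (n := m)
    (a := x) (b := y) (y := y) (K := M) (η := 0) le_rfl ⟨hxy, le_rfl⟩
    (fun i _ s _ => hasDerivAt_eval_iterate_derivative G i s)
    (fun s hs => by rw [hGm]; exact hM s hs)
    (fun j hj => by
      rw [eval_iterate_derivative_eq_zero_of_pow_dvd hj (pow_dvd_sub_modByMonic m y H), abs_zero,
        zero_pow (by omega), mul_zero])
    hi.le (t := x) ⟨le_rfl, hxy⟩
  rw [zero_add, abs_sub_comm, abs_of_nonneg (sub_nonneg.2 hxy)] at key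
  rw [iterate_derivative_sub, eval_sub, eval_iterate_derivative_modByMonic hi, ← eval_sub,
    ← iterate_derivative_sub, mul_assoc, ← pow_succ', show m - 1 - i + 1 = m - i by omega]
  exact key

/-! ### Bridging two polynomials over an interval -/

/-- The polynomial `B + θ ((X - a) / (b - a)) (A - B)`. When `θ` is `1` to order `m` at `0` and
vanishes to order `m` at `1`, it has the jet of `A` at `a` and the jet of `B` at `b`. -/
noncomputable def bridge (θ : ℝ[X]) (a b : ℝ) (A B : ℝ[X]) : ℝ[X] :=
  B + θ.comp (C (b - a)⁻¹ * (X - C a)) * (A - B)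

theorem bridge_self (θ : ℝ[X]) (a b : ℝ) (A : ℝ[X]) : bridge θ a b A A = A := by
  simp [bridge]

theorem pow_dvd_bridge_sub_left {m : ℕ} {θ : ℝ[X]} (hθ : X ^ m ∣ θ - 1) (a b : ℝ)
    (A B : ℝ[X]) : (X - C a) ^ m ∣ bridge θ a b A B - A := by
  obtain ⟨ρ, hρ⟩ := hθ
  have h : θ.comp (C (b - a)⁻¹ * (X - C a)) - 1 =
      (C (b - a)⁻¹ * (X - C a)) ^ m * ρ.comp (C (b - a)⁻¹ * (X - C a)) := by
    have := congrArg (fun q : ℝ[X] => q.comp (C (b - a)⁻¹ * (X - C a))) hρ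
    simpa only [sub_comp, one_comp, mul_comp, pow_comp, X_comp] using this
  refine ⟨C (b - a)⁻¹ ^ m * ρ.comp (C (b - a)⁻¹ * (X - C a)) * (A - B), ?_⟩
  rw [bridge]
  rw [mul_pow] at h
  linear_combination (A - B) * h

theorem pow_dvd_bridge_sub_right {m : ℕ} {θ : ℝ[X]} (hθ : (X - 1) ^ m ∣ θ) {a b : ℝ}
    (hab : a < b) (A B : ℝ[X]) : (X - C b) ^ m ∣ bridge θ a b A B - B := by
  obtain ⟨ρ, hρ⟩ := hθ
  have hL : C (b - a)⁻¹ * (X - C a) - 1 = C (b - a)⁻¹ * (X - C b) := by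
    have h1 : C (b - a)⁻¹ * (C b - C a) = (1 : ℝ[X]) := by
      rw [← C_sub, ← C_mul, inv_mul_cancel₀ (sub_pos.2 hab).ne', C_1]
    linear_combination h1
  have h : θ.comp (C (b - a)⁻¹ * (X - C a)) =
      (C (b - a)⁻¹ * (X - C b)) ^ m * ρ.comp (C (b - a)⁻¹ * (X - C a)) := by
    have := congrArg (fun q : ℝ[X] => q.comp (C (b - a)⁻¹ * (X - C a))) hρ
    simpa only [sub_comp, one_comp, mul_comp, pow_comp, X_comp, hL] using this
  refine ⟨C (b - a)⁻¹ ^ m * ρ.comp (C (b - a)⁻¹ * (X - C a)) * (A - B), ?_⟩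
  rw [bridge]
  rw [mul_pow] at h
  linear_combination (A - B) * h

theorem exists_transition_polynomial (m : ℕ) :
    ∃ θ : ℝ[X], X ^ m ∣ θ - 1 ∧ (X - 1) ^ m ∣ θ := by
  have hc : IsCoprime (X : ℝ[X]) (X - 1) := ⟨1, -1, by ring⟩
  obtain ⟨u, v, huv⟩ := hc.pow (m := m) (n := m)
  exact ⟨v * (X - 1) ^ m, ⟨-u, by linear_combination huv⟩, ⟨v, by ring⟩⟩

theorem iterate_derivative_comp_affine (θ : ℝ[X]) (c a : ℝ) (k : ℕ) :
    derivative^[k] (θ.comp (C c * (X - C a))) =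
      C c ^ k * (derivative^[k] θ).comp (C c * (X - C a)) := by
  induction k with
  | zero => simp
  | succ k ih =>
    rw [Function.iterate_succ_apply', ih, Function.iterate_succ_apply', ← C_pow,
      derivative_C_mul, derivative_comp, derivative_C_mul]
    simp only [derivative_sub, derivative_X, derivative_C, sub_zero, mul_one, map_pow]
    ring

/-- The derivative of order `m` of a bridge is of the size that the compatibility of the two jets
predicts. -/
theorem exists_abs_iterate_derivative_bridge_le {m : ℕ} (θ : ℝ[X]) :
    ∃ c : ℝ, 1 ≤ c ∧ ∀ (a b : ℝ) (A B : ℝ[X]) (K : ℝ), a < b → 0 ≤ K → A.natDegree < m →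
      B.natDegree < m → JetClose m A B K a b → ∀ t ∈ Set.Icc a b,
        |(derivative^[m] (bridge θ a b A B)).eval t| ≤ c * (K / (b - a)) := by
  have hbd : ∀ j : ℕ, ∃ M : ℝ, ∀ s ∈ Set.Icc (0 : ℝ) 1, |(derivative^[j] θ).eval s| ≤ M := by
    intro j
    obtain ⟨M, hM⟩ := (isCompact_Icc (a := (0 : ℝ)) (b := 1)).exists_bound_of_continuousOn
      (derivative^[j] θ).continuous.continuousOn
    exact ⟨M, fun s hs => by simpa using hM s hs⟩
  choose M hM using hbd
  have hM0 : ∀ j, 0 ≤ M j := fun j => (abs_nonneg _).trans (hM j 0 (by simp))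
  refine ⟨1 + ∑ k ∈ Finset.range (m + 1), m.choose k * (M (m - k) * 2 ^ m), ?_, ?_⟩
  · have : 0 ≤ ∑ k ∈ Finset.range (m + 1), (m.choose k : ℝ) * (M (m - k) * 2 ^ m) :=
      Finset.sum_nonneg fun k _ => by have := hM0 (m - k); positivity
    linarith
  intro a b A B K hab hK hA hB hclose t ht
  have hh : 0 < b - a := sub_pos.2 hab
  have hAB : (A - B).natDegree < m := (natDegree_sub_le A B).trans_lt (max_lt hA hB)
  have hs : (b - a)⁻¹ * (t - a) ∈ Set.Icc (0 : ℝ) 1 := by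
    rw [inv_mul_eq_div]
    exact ⟨div_nonneg (sub_nonneg.2 ht.1) hh.le, (div_le_one hh).2 (by linarith [ht.2])⟩
  have hterm : ∀ k ∈ Finset.range (m + 1),
      |(m.choose k • (derivative^[m - k] (θ.comp (C (b - a)⁻¹ * (X - C a))) *
        derivative^[k] (A - B))).eval t| ≤
      m.choose k * (M (m - k) * 2 ^ m) * (K / (b - a)) := by
    intro k hk
    rw [nsmul_eq_mul, eval_mul, eval_natCast, eval_mul, iterate_derivative_comp_affine, eval_mul,
      eval_pow, eval_C, eval_comp, abs_mul, abs_mul, abs_mul, Nat.abs_cast]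
    simp only [eval_mul, eval_C, eval_sub, eval_X]
    rw [abs_of_nonneg (by positivity : (0 : ℝ) ≤ (b - a)⁻¹ ^ (m - k))]
    rcases (Nat.lt_succ_iff.1 (Finset.mem_range.1 hk)).eq_or_lt with rfl | hkm
    · -- the polynomial `A - B` has degree less than `m`
      rw [iterate_derivative_eq_zero hAB, eval_zero, abs_zero, mul_zero, mul_zero]
      have := hM0 (k - k)
      positivity
    · have h1 := hclose.abs_eval_le hab.le hAB t hkm
      have h2 : K * (b - a + |t - a|) ^ (m - 1 - k) ≤ 2 ^ m * (K * (b - a) ^ (m - 1 - k)) := by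
        have : b - a + |t - a| ≤ 2 * (b - a) := by
          rw [abs_of_nonneg (sub_nonneg.2 ht.1)]; linarith [ht.2]
        calc K * (b - a + |t - a|) ^ (m - 1 - k) ≤ K * (2 * (b - a)) ^ (m - 1 - k) := by gcongr
          _ = 2 ^ (m - 1 - k) * (K * (b - a) ^ (m - 1 - k)) := by rw [mul_pow]; ring
          _ ≤ _ := by
            gcongr
            · norm_num
            · omega
      have h3 := hM (m - k) _ hs
      have hm0 := hM0 (m - k)
      calc (m.choose k : ℝ) * ((b - a)⁻¹ ^ (m - k) *
              |(derivative^[m - k] θ).eval ((b - a)⁻¹ * (t - a))| *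
              |(derivative^[k] (A - B)).eval t|)
          ≤ m.choose k * ((b - a)⁻¹ ^ (m - k) * M (m - k) *
              (2 ^ m * (K * (b - a) ^ (m - 1 - k)))) := by
            gcongr
            exact h1.trans h2
        _ = m.choose k * (M (m - k) * 2 ^ m) *
              (K * ((b - a)⁻¹ ^ (m - k) * (b - a) ^ (m - 1 - k))) := by ring
        _ = _ := by
            have e : (b - a)⁻¹ ^ (m - k) * (b - a) ^ (m - 1 - k) = (b - a)⁻¹ := by
              rw [show m - k = m - 1 - k + 1 by omega, pow_succ, mul_right_comm, ← mul_pow,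
                inv_mul_cancel₀ hh.ne', one_pow, one_mul]
            rw [e, ← div_eq_mul_inv]
  rw [bridge, iterate_map_add, iterate_derivative_eq_zero hB, zero_add,
    iterate_derivative_mul, eval_finsetSum]
  refine (Finset.abs_sum_le_sum_abs _ _).trans ((Finset.sum_le_sum hterm).trans ?_)
  rw [← Finset.sum_mul]
  have : 0 ≤ K / (b - a) := div_nonneg hK hh.le
  nlinarith

/-! ### Extension of a field of jets from a closed set to the line -/

/-- Every point `x` has neighbours `l` and `r` in a nonempty closed set `E`: the last point of `E`
before `x` and the first one after `x`. On an unbounded complementary interval both are the end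
point of that interval. -/
theorem exists_neighbours {E : Set ℝ} (hE : IsClosed E) (hne : E.Nonempty) (x : ℝ) :
    ∃ l ∈ E, ∃ r ∈ E, (∀ e ∈ E, e ≤ x → e ≤ l) ∧ (∀ e ∈ E, x ≤ e → r ≤ e) ∧
      ((l ≤ x ∧ x ≤ r) ∨ (l = r ∧ ∀ e ∈ E, x < e) ∨ (l = r ∧ ∀ e ∈ E, e < x)) := by
  have hleft : (E ∩ Set.Iic x).Nonempty → ∃ l ∈ E, l ≤ x ∧ ∀ e ∈ E, e ≤ x → e ≤ l := fun h =>
    have hb : BddAbove (E ∩ Set.Iic x) := ⟨x, fun e he => he.2⟩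
    have hmem := (hE.inter isClosed_Iic).csSup_mem h hb
    ⟨_, hmem.1, hmem.2, fun e he hex => le_csSup hb ⟨he, hex⟩⟩
  have hright : (E ∩ Set.Ici x).Nonempty → ∃ r ∈ E, x ≤ r ∧ ∀ e ∈ E, x ≤ e → r ≤ e := fun h =>
    have hb : BddBelow (E ∩ Set.Ici x) := ⟨x, fun e he => he.2⟩
    have hmem := (hE.inter isClosed_Ici).csInf_mem h hb
    ⟨_, hmem.1, hmem.2, fun e he hex => csInf_le hb ⟨he, hex⟩⟩
  by_cases h1 : (E ∩ Set.Iic x).Nonempty <;> by_cases h2 : (E ∩ Set.Ici x).Nonempty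
  · obtain ⟨l, hl, hlx, hl'⟩ := hleft h1
    obtain ⟨r, hr, hrx, hr'⟩ := hright h2
    exact ⟨l, hl, r, hr, hl', hr', Or.inl ⟨hlx, hrx⟩⟩
  · obtain ⟨l, hl, hlx, hl'⟩ := hleft h1
    have hlt : ∀ e ∈ E, e < x := fun e he => lt_of_not_ge fun h => h2 ⟨e, he, h⟩
    exact ⟨l, hl, l, hl, hl', fun e he h => absurd (hlt e he) h.not_gt, Or.inr (Or.inr ⟨rfl, hlt⟩)⟩
  · obtain ⟨r, hr, hrx, hr'⟩ := hright h2
    have hlt : ∀ e ∈ E, x < e := fun e he => lt_of_not_ge fun h => h1 ⟨e, he, h⟩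
    exact ⟨r, hr, r, hr, fun e he h => absurd (hlt e he) h.not_gt, hr', Or.inr (Or.inl ⟨rfl, hlt⟩)⟩
  · obtain ⟨e, he⟩ := hne
    exact ((le_total e x).elim (fun h => h1 ⟨e, he, h⟩) (fun h => h2 ⟨e, he, h⟩)).elim

/-- A field of jets on `E` that is controlled by a monotone function `Ω` extends to a field on the
line, controlled up to a factor by a monotone function with the same bounds. The jets are bridged
and `Ω` is interpolated linearly over the bounded complementary intervals; both are constant on
the unbounded ones. -/
theorem exists_jet_field_extension {m : ℕ} (hm : 1 ≤ m) :
    ∃ c : ℝ, 1 ≤ c ∧ ∀ (p : ℝ), 1 < p → ∀ (E : Set ℝ), IsClosed E → E.Nonempty →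
      ∀ (P : ℝ → ℝ[X]) (Ω : ℝ → ℝ) (α β : ℝ), (∀ x ∈ E, (P x).natDegree < m) →
      MonotoneOn Ω E → (∀ x ∈ E, Ω x ∈ Set.Icc α β) →
      (∀ x ∈ E, ∀ y ∈ E, x < y → JetClose m (P x) (P y) (geomIncrement p Ω x y) x y) →
      ∃ (Q : ℝ → ℝ[X]) (Ψ : ℝ → ℝ), (∀ x, (Q x).natDegree < m) ∧ (∀ x ∈ E, Q x = P x) ∧
        Monotone Ψ ∧ (∀ x, Ψ x ∈ Set.Icc α β) ∧
        ∀ x y, x ≤ y → JetClose m (Q x) (Q y) (c * geomIncrement p Ψ x y) x y := by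
  obtain ⟨θ, hθ0, hθ1⟩ := exists_transition_polynomial m
  obtain ⟨c, hc1, hc⟩ := exists_abs_iterate_derivative_bridge_le (m := m) θ
  refine ⟨c, hc1, fun p hp E hE hne P Ω α β hdeg hmono hbound hclose => ?_⟩
  choose l hlE r hrE hl hr hcase using exists_neighbours hE hne
  set Q : ℝ → ℝ[X] := fun x => bridge θ (l x) (r x) (P (l x)) (P (r x)) %ₘ (X - C x) ^ m with hQ
  set Ψ : ℝ → ℝ := fun x => Ω (l x) + (x - l x) / (r x - l x) * (Ω (r x) - Ω (l x)) with hΨ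
  have hc0 : 0 ≤ c := by linarith
  have hQdeg : ∀ x, (Q x).natDegree < m := fun x => natDegree_modByMonic_X_sub_C_pow_lt hm x _
  have hQsub : ∀ x y, (Q x - Q y).natDegree < m := fun x y =>
    (natDegree_sub_le _ _).trans_lt (max_lt (hQdeg x) (hQdeg y))
  -- where the two neighbours coincide, nothing is bridged
  have hQdiag : ∀ x, l x = r x → Q x = P (l x) := by
    intro x h
    simp only [hQ, ← h, bridge_self]
    exact modByMonic_X_sub_C_pow_eq_of_dvd (hdeg _ (hlE x)) (by simp)
  have hΨdiag : ∀ x, l x = r x → Ψ x = Ω (l x) := by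
    intro x h
    simp [hΨ, ← h]
  have hlr : ∀ x ∈ E, l x = x ∧ r x = x := by
    intro x hx
    have h1 := hl x x hx le_rfl
    have h2 := hr x x hx le_rfl
    rcases hcase x with h | h | h
    · exact ⟨le_antisymm h.1 h1, le_antisymm h2 h.2⟩
    · exact absurd (h.2 x hx) (lt_irrefl x)
    · exact absurd (h.2 x hx) (lt_irrefl x)
  have hQE : ∀ x ∈ E, Q x = P x := fun x hx => by
    rw [hQdiag x ((hlr x hx).1.trans (hlr x hx).2.symm), (hlr x hx).1]
  have hΨE : ∀ x ∈ E, Ψ x = Ω x := fun x hx => by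
    rw [hΨdiag x ((hlr x hx).1.trans (hlr x hx).2.symm), (hlr x hx).1]
  let Rel : ℝ → ℝ → Prop := fun x y =>
    Ψ x ≤ Ψ y ∧ JetClose m (Q x) (Q y) (c * geomIncrement p Ψ x y) x y
  have hrefl : ∀ x y, x ≤ y → Q x = Q y → Ψ x = Ψ y → Rel x y := by
    intro x y hxy h1 h2
    refine ⟨h2.le, ?_⟩
    rw [h1]
    exact JetClose.refl m _ (mul_nonneg hc0 (geomIncrement_nonneg h2.le hxy)) hxy
  have htrans : ∀ x y z, x ≤ y → y ≤ z → Rel x y → Rel y z → Rel x z := by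
    rintro x y z hxy hyz ⟨h1, h2⟩ ⟨h3, h4⟩
    refine ⟨h1.trans h3, ?_⟩
    refine (h2.trans h4 hxy hyz (mul_nonneg hc0 (geomIncrement_nonneg h1 hxy)) (hQsub y z)).mono
      ?_ (hxy.trans hyz)
    rw [← mul_add]
    exact mul_le_mul_of_nonneg_left (geomIncrement_add_le hp hxy hyz h1 h3) hc0
  have hRelE : ∀ x ∈ E, ∀ y ∈ E, x ≤ y → Rel x y := by
    intro x hx y hy hxy
    rcases hxy.eq_or_lt with rfl | hlt
    · exact hrefl x x le_rfl rfl rfl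
    · have hΩ := hmono hx hy hxy
      have hg : geomIncrement p Ψ x y = geomIncrement p Ω x y := by
        simp only [geomIncrement, hΨE x hx, hΨE y hy]
      refine ⟨by rwa [hΨE x hx, hΨE y hy], ?_⟩
      rw [hQE x hx, hQE y hy, hg]
      exact (hclose x hx y hy hlt).mono
        (le_mul_of_one_le_left (geomIncrement_nonneg hΩ hxy) hc1) hxy
  -- inside one complementary interval
  have hgap : ∀ a ∈ E, ∀ b ∈ E, a < b → (∀ e ∈ E, e ≤ a ∨ b ≤ e) →
      ∀ x y, a ≤ x → x ≤ y → y ≤ b → Rel x y := by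
    intro a ha b hb hab hE' x y hax hxy hyb
    have hh : 0 < b - a := sub_pos.2 hab
    have hform : ∀ t ∈ Set.Icc a b, Q t = bridge θ a b (P a) (P b) %ₘ (X - C t) ^ m ∧
        Ψ t = Ω a + (t - a) / (b - a) * (Ω b - Ω a) := by
      intro t ht
      rcases ht.1.eq_or_lt with rfl | hat
      · refine ⟨?_, by rw [hΨE _ ha]; simp⟩
        rw [hQE _ ha, modByMonic_X_sub_C_pow_eq_of_dvd (hdeg _ ha)
          (pow_dvd_bridge_sub_left hθ0 _ _ _ _)]
      rcases ht.2.eq_or_lt with rfl | htb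
      · refine ⟨?_, by rw [hΨE _ hb, div_self hh.ne']; ring⟩
        rw [hQE _ hb, modByMonic_X_sub_C_pow_eq_of_dvd (hdeg _ hb)
          (pow_dvd_bridge_sub_right hθ1 hab _ _)]
      have h1 := hl t a ha hat.le
      have h2 := hr t b hb htb.le
      have hla : l t = a ∧ r t = b := by
        rcases hcase t with h | h | h
        · refine ⟨le_antisymm ?_ h1, le_antisymm h2 ?_⟩
          · exact (hE' _ (hlE t)).resolve_right fun h' => by linarith
          · exact (hE' _ (hrE t)).resolve_left fun h' => by linarith
        · exact absurd (h.2 a ha) hat.not_gt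
        · exact absurd (h.2 b hb) htb.not_gt
      simp only [hQ, hΨ, hla.1, hla.2, and_self]
    have hΩ := hmono ha hb hab.le
    obtain ⟨hQx, hΨx⟩ := hform x ⟨hax, hxy.trans hyb⟩
    obtain ⟨hQy, hΨy⟩ := hform y ⟨hax.trans hxy, hyb⟩
    have hinc : Ψ y - Ψ x = (Ω b - Ω a) * ((y - x) / (b - a)) := by
      rw [hΨx, hΨy]; field_simp; ring
    have hfrac : 0 ≤ (y - x) / (b - a) := div_nonneg (sub_nonneg.2 hxy) hh.le
    have hgeom : geomIncrement p Ψ x y = geomIncrement p Ω a b / (b - a) * (y - x) := by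
      have e : y - x = (b - a) * ((y - x) / (b - a)) := by field_simp
      rw [geomIncrement, hinc]
      nth_rw 2 [e]
      rw [Real.mul_rpow (sub_nonneg.2 hΩ) hfrac, Real.mul_rpow hh.le hfrac, mul_mul_mul_comm,
        ← Real.rpow_add_of_nonneg hfrac (by positivity)
          (sub_nonneg.2 ((div_le_one (by linarith)).2 hp.le)),
        add_sub_cancel, Real.rpow_one, geomIncrement]
      ring
    refine ⟨sub_nonneg.1 (hinc ▸ mul_nonneg (sub_nonneg.2 hΩ) hfrac), ?_⟩
    rw [hQx, hQy, hgeom, ← mul_assoc]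
    refine jetClose_modByMonic hm hxy fun t ht => ?_
    exact hc a b _ _ _ hab (geomIncrement_nonneg hΩ hab.le) (hdeg a ha) (hdeg b hb)
      (hclose a ha b hb hab) t ⟨hax.trans ht.1, ht.2.trans hyb⟩
  have hempty : ∀ x y, x ≤ y → (∀ e ∈ E, e ≤ x ∨ y ≤ e) → Rel x y := by
    intro x y hxy h
    by_cases hA : ∃ a ∈ E, a ≤ x
    · by_cases hB : ∃ b ∈ E, y ≤ b
      · obtain ⟨a, ha, hax⟩ := hA
        obtain ⟨b, hb, hyb⟩ := hB
        rcases hxy.eq_or_lt with rfl | hlt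
        · exact hrefl x x le_rfl rfl rfl
        have h1 : l x ≤ x := by
          rcases hcase x with h' | h' | h'
          · exact h'.1
          · exact absurd (h'.2 a ha) hax.not_gt
          · exact (h'.2 _ (hlE x)).le
        have h2 : y ≤ r y := by
          rcases hcase y with h' | h' | h'
          · exact h'.2
          · exact (h'.2 _ (hrE y)).le
          · exact absurd (h'.2 b hb) hyb.not_gt
        exact hgap (l x) (hlE x) (r y) (hrE y) (by linarith)
          (fun e he => (h e he).imp (hl x e he) (hr y e he)) x y h1 hxy h2
      · -- no point of `E` after `x`
        have hB' : ∀ e ∈ E, e < y := fun e he => lt_of_not_ge fun h' => hB ⟨e, he, h'⟩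
        have hle : ∀ e ∈ E, e ≤ x := fun e he => (h e he).resolve_right (hB' e he).not_ge
        have e1 : l y = r y := by
          rcases hcase y with h' | h' | h'
          · exact absurd (hB' _ (hrE y)) h'.2.not_gt
          · exact h'.1
          · exact h'.1
        have e2 : l x = r x := by
          rcases hcase x with h' | h' | h'
          · have hrx : r x = x := le_antisymm (hle _ (hrE x)) h'.2
            rw [hrx]
            exact le_antisymm h'.1 (hl x x (hrx ▸ hrE x) le_rfl)
          · exact h'.1
          · exact h'.1
        have e3 : l x = l y := le_antisymm (hl y _ (hlE x) ((hle _ (hlE x)).trans hxy))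
          (hl x _ (hlE y) (hle _ (hlE y)))
        exact hrefl x y hxy (by rw [hQdiag x e2, hQdiag y e1, e3])
          (by rw [hΨdiag x e2, hΨdiag y e1, e3])
    · -- no point of `E` before `y`
      have hA' : ∀ e ∈ E, x < e := fun e he => lt_of_not_ge fun h' => hA ⟨e, he, h'⟩
      have hle : ∀ e ∈ E, y ≤ e := fun e he => (h e he).resolve_left (hA' e he).not_ge
      have e1 : l x = r x := by
        rcases hcase x with h' | h' | h'
        · exact absurd (hA' _ (hlE x)) h'.1.not_gt
        · exact h'.1
        · exact h'.1
      have e2 : l y = r y := by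
        rcases hcase y with h' | h' | h'
        · have hly : l y = y := le_antisymm h'.1 (hle _ (hlE y))
          rw [hly]
          exact le_antisymm h'.2 (hr y y (hly ▸ hlE y) le_rfl)
        · exact h'.1
        · exact h'.1
      have e3 : l x = l y := by
        rw [e1, e2]
        exact le_antisymm (hr x _ (hrE y) (hxy.trans (hle _ (hrE y))))
          (hr y _ (hrE x) (hle _ (hrE x)))
      exact hrefl x y hxy (by rw [hQdiag x e1, hQdiag y e2, e3])
        (by rw [hΨdiag x e1, hΨdiag y e2, e3])
  have hRel : ∀ x y, x ≤ y → Rel x y := by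
    intro x y hxy
    by_cases h : ∃ e ∈ E, x < e ∧ e < y
    · obtain ⟨e, he, hxe, hey⟩ := h
      have h1 : x ≤ r x := by
        rcases hcase x with h' | h' | h'
        · exact h'.2
        · exact (h'.2 _ (hrE x)).le
        · exact absurd (h'.2 e he) hxe.not_gt
      have h2 : l y ≤ y := by
        rcases hcase y with h' | h' | h'
        · exact h'.1
        · exact absurd (h'.2 e he) hey.not_gt
        · exact (h'.2 _ (hlE y)).le
      have h3 : r x ≤ l y := (hr x e he hxe.le).trans (hl y e he hey.le)
      refine htrans x (l y) y (h1.trans h3) h2 (htrans x (r x) (l y) h1 h3 ?_ ?_) ?_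
      · exact hempty _ _ h1 fun e he => (le_total e x).imp id (hr x e he)
      · exact hRelE _ (hrE x) _ (hlE y) h3
      · exact hempty _ _ h2 fun e he => (le_total e y).imp (hl y e he) id
    · exact hempty x y hxy fun e he => by
        by_contra! h'
        exact h ⟨e, he, h'⟩
  have hΨmono : Monotone Ψ := fun x y hxy => (hRel x y hxy).1
  refine ⟨Q, Ψ, hQdeg, hQE, hΨmono, fun x => ?_, fun x y hxy => (hRel x y hxy).2⟩
  rcases hcase x with h | h | h
  · exact ⟨(hbound _ (hlE x)).1.trans (hΨE _ (hlE x) ▸ hΨmono h.1),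
      (hΨE _ (hrE x) ▸ hΨmono h.2 : Ψ x ≤ Ω (r x)).trans (hbound _ (hrE x)).2⟩
  all_goals exact hΨdiag x h.1 ▸ hbound _ (hlE x)

/-! ### Functions whose increments are dominated by a geometric mean -/

/-- The increments of a bounded monotone function over disjoint intervals. -/
theorem sum_abs_sub_le_of_monotone {Ψ : ℝ → ℝ} {α β : ℝ} (hΨ : Monotone Ψ)
    (hb : ∀ x, Ψ x ∈ Set.Icc α β) {ι : Type*} (s : Finset ι) (I : ι → ℝ × ℝ)
    (hd : Set.PairwiseDisjoint (s : Set ι) fun i => Set.uIoc (I i).1 (I i).2) :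
    ∑ i ∈ s, |Ψ (I i).2 - Ψ (I i).1| ≤ β - α := by
  have hαβ : α ≤ β := (hb 0).1.trans (hb 0).2
  have hd' : Set.PairwiseDisjoint (s : Set ι)
      fun i => Set.uIoc (Ψ (I i).1) (Ψ (I i).2) := by
    intro i hi j hj hij
    have h := hd hi hj hij
    simp only [Function.onFun, Set.uIoc, Set.Ioc_disjoint_Ioc] at h ⊢
    simp only [← hΨ.map_max, ← hΨ.map_min]
    exact hΨ h
  have h1 := measureReal_biUnion_finset (μ := volume) (s := s) hd'
    (fun i _ => measurableSet_uIoc) (fun i _ => by simp [Set.uIoc])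
  have h2 : ∑ i ∈ s, |Ψ (I i).2 - Ψ (I i).1| =
      ∑ i ∈ s, volume.real (Set.uIoc (Ψ (I i).1) (Ψ (I i).2)) :=
    Finset.sum_congr rfl fun i _ => by
      rw [Set.uIoc, Real.volume_real_Ioc_of_le min_le_max, max_sub_min_eq_abs]
  rw [h2, ← h1]
  calc _ ≤ volume.real (Set.Icc α β) := by
        refine measureReal_mono (Set.iUnion₂_subset fun i _ => ?_) (by simp)
        exact Set.uIoc_subset_uIcc.trans (Set.ordConnected_Icc.uIcc_subset (hb _) (hb _))
    _ = β - α := Real.volume_real_Icc_of_le hαβ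

theorem absolutelyContinuousOnInterval_of_le_geomIncrement {p c α β : ℝ} (hp : 1 < p)
    {f Ψ : ℝ → ℝ} (hΨ : Monotone Ψ) (hb : ∀ x, Ψ x ∈ Set.Icc α β) (hc : 0 ≤ c)
    (hf : ∀ x y, x ≤ y → |f x - f y| ≤ c * geomIncrement p Ψ x y) (a b : ℝ) :
    AbsolutelyContinuousOnInterval f a b := by
  have hp1 : 0 < 1 - 1 / p := sub_pos.2 ((div_lt_one (by linarith)).2 hp)
  have hf' : ∀ x y, dist (f x) (f y) ≤
      c * (|Ψ y - Ψ x| ^ (1 / p) * dist x y ^ (1 - 1 / p)) := by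
    intro x y
    wlog hxy : x ≤ y generalizing x y
    · rw [dist_comm, abs_sub_comm, dist_comm x]
      exact this y x (le_of_not_ge hxy)
    · rw [Real.dist_eq, dist_comm x, Real.dist_eq, abs_of_nonneg (sub_nonneg.2 (hΨ hxy)),
        abs_of_nonneg (sub_nonneg.2 hxy)]
      exact hf x y hxy
  have hlen : Filter.Tendsto
      (fun E : ℕ × (ℕ → ℝ × ℝ) => ∑ i ∈ Finset.range E.1, dist (E.2 i).1 (E.2 i).2)
      (AbsolutelyContinuousOnInterval.totalLengthFilter ⊓
        Filter.principal (AbsolutelyContinuousOnInterval.disjWithin a b)) (nhds 0) :=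
    Filter.tendsto_comap.mono_left inf_le_left
  have hlim := ((hlen.rpow_const (p := 1 - 1 / p) (Or.inr hp1.le)).const_mul
    (c * (β - α) ^ (1 / p)))
  rw [Real.zero_rpow hp1.ne', mul_zero] at hlim
  refine squeeze_zero' (Filter.Eventually.of_forall fun E =>
    Finset.sum_nonneg fun i _ => dist_nonneg) ?_ hlim
  refine Filter.eventually_inf_principal.2 (Filter.Eventually.of_forall fun E hE => ?_)
  have hsum := sum_abs_sub_le_of_monotone hΨ hb (Finset.range E.1) E.2 hE.2
  calc ∑ i ∈ Finset.range E.1, dist (f (E.2 i).1) (f (E.2 i).2)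
      ≤ ∑ i ∈ Finset.range E.1, c * (|Ψ (E.2 i).2 - Ψ (E.2 i).1| ^ (1 / p) *
          dist (E.2 i).1 (E.2 i).2 ^ (1 - 1 / p)) := Finset.sum_le_sum fun i _ => hf' _ _
    _ ≤ c * ((∑ i ∈ Finset.range E.1, |Ψ (E.2 i).2 - Ψ (E.2 i).1|) ^ (1 / p) *
          (∑ i ∈ Finset.range E.1, dist (E.2 i).1 (E.2 i).2) ^ (1 - 1 / p)) := by
        rw [← Finset.mul_sum]
        exact mul_le_mul_of_nonneg_left (sum_rpow_mul_rpow_le _ hp (fun i _ => abs_nonneg _)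
          fun i _ => dist_nonneg) hc
    _ ≤ c * ((β - α) ^ (1 / p) *
          (∑ i ∈ Finset.range E.1, dist (E.2 i).1 (E.2 i).2) ^ (1 - 1 / p)) := by
        have h0 : 0 ≤ ∑ i ∈ Finset.range E.1, |Ψ (E.2 i).2 - Ψ (E.2 i).1| :=
          Finset.sum_nonneg fun i _ => abs_nonneg _
        have h1 : 0 ≤ ∑ i ∈ Finset.range E.1, dist (E.2 i).1 (E.2 i).2 :=
          Finset.sum_nonneg fun i _ => dist_nonneg
        gcongr
    _ = _ := by ring

/-- Pointwise form of the domination: the difference quotients pass to the limit. -/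
theorem abs_deriv_le_of_le_geomIncrement {p c : ℝ} (hp : 1 < p) {f Ψ : ℝ → ℝ}
    (hΨ : Monotone Ψ) (hf : ∀ x y, x ≤ y → |f x - f y| ≤ c * geomIncrement p Ψ x y) {x : ℝ}
    (hfx : DifferentiableAt ℝ f x) (hΨx : DifferentiableAt ℝ Ψ x) :
    |deriv f x| ≤ c * deriv Ψ x ^ (1 / p) := by
  have hle : nhdsWithin x (Set.Ioi x) ≤ nhdsWithin x {x}ᶜ :=
    nhdsWithin_mono x fun y hy => ne_of_gt hy
  have h1 := ((hasDerivAt_iff_tendsto_slope.1 hfx.hasDerivAt).mono_left hle).abs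
  have h2 := (((hasDerivAt_iff_tendsto_slope.1 hΨx.hasDerivAt).mono_left hle).rpow_const
    (p := 1 / p) (Or.inr (by positivity))).const_mul c
  refine le_of_tendsto_of_tendsto h1 h2 ?_
  filter_upwards [self_mem_nhdsWithin] with y hy
  have hxy : 0 < y - x := sub_pos.2 hy
  have h := hf x y (le_of_lt hy)
  rw [slope_def_field, slope_def_field, abs_div, abs_of_pos hxy, div_le_iff₀ hxy,
    Real.div_rpow (sub_nonneg.2 (hΨ (le_of_lt hy))) hxy.le, abs_sub_comm]
  refine h.trans_eq ?_
  rw [geomIncrement, Real.rpow_sub hxy, Real.rpow_one]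
  ring

theorem lintegral_deriv_le_of_monotone {Ψ : ℝ → ℝ} {α β : ℝ} (hΨ : Monotone Ψ)
    (hb : ∀ x, Ψ x ∈ Set.Icc α β) :
    ∫⁻ x, ENNReal.ofReal (deriv Ψ x) ≤ ENNReal.ofReal (β - α) := by
  have hcov : AECover volume Filter.atTop fun n : ℕ => Set.Ioc (-(n : ℝ)) n :=
    aecover_Ioc (Filter.tendsto_neg_atTop_atBot.comp tendsto_natCast_atTop_atTop)
      tendsto_natCast_atTop_atTop
  refine le_of_tendsto (hcov.lintegral_tendsto_of_countably_generated
    (measurable_deriv Ψ).ennreal_ofReal.aemeasurable) (Filter.Eventually.of_forall fun n => ?_)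
  have hn : -(n : ℝ) ≤ n := by have : (0 : ℝ) ≤ n := n.cast_nonneg; linarith
  have hmon : MonotoneOn Ψ (Set.uIcc (-(n : ℝ)) n) := hΨ.monotoneOn _
  have hint := (intervalIntegrable_iff_integrableOn_Ioc_of_le hn).1 hmon.intervalIntegrable_deriv
  have hnn : ∀ x, 0 ≤ deriv Ψ x := fun x => hΨ.deriv_nonneg
  rw [← ofReal_integral_eq_lintegral_ofReal hint (Filter.Eventually.of_forall hnn),
    ← intervalIntegral.integral_of_le hn]
  refine ENNReal.ofReal_le_ofReal ?_
  have h := hmon.intervalIntegral_deriv_mem_uIcc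
  rw [Set.uIcc_of_le (sub_nonneg.2 (hΨ hn))] at h
  have h1 := (hb n).2
  have h2 := (hb (-(n : ℝ))).1
  linarith [h.2]

theorem eLpNorm_deriv_le_of_le_geomIncrement {p c α β : ℝ} (hp : 1 < p)
    {f Ψ : ℝ → ℝ} (hΨ : Monotone Ψ) (hb : ∀ x, Ψ x ∈ Set.Icc α β) (hc : 0 ≤ c)
    (hf : ∀ x y, x ≤ y → |f x - f y| ≤ c * geomIncrement p Ψ x y) :
    eLpNorm (deriv f) (ENNReal.ofReal p) volume ≤
      ENNReal.ofReal c * ENNReal.ofReal (β - α) ^ (1 / p) := by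
  have hp0 : 0 < p := by linarith
  have hfae : ∀ᵐ x, DifferentiableAt ℝ f x := by
    have h : ∀ n : ℕ, ∀ᵐ x, x ∈ Set.uIcc (-(n : ℝ)) n → DifferentiableAt ℝ f x := fun n =>
      (absolutelyContinuousOnInterval_of_le_geomIncrement hp hΨ hb hc hf _ _).ae_differentiableAt
    filter_upwards [ae_all_iff.2 h] with x hx
    obtain ⟨n, hn⟩ := exists_nat_ge |x|
    exact hx n (Set.Icc_subset_uIcc (abs_le.1 hn))
  rw [eLpNorm_eq_lintegral_rpow_enorm_toReal (by simpa using hp0) ENNReal.ofReal_ne_top,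
    ENNReal.toReal_ofReal hp0.le]
  have hpt : ∀ᵐ x, ‖deriv f x‖ₑ ^ p ≤
      ENNReal.ofReal c ^ p * ENNReal.ofReal (deriv Ψ x) := by
    filter_upwards [hfae, hΨ.ae_differentiableAt] with x h1 h2
    have h := abs_deriv_le_of_le_geomIncrement hp hΨ hf h1 h2
    have hnn : 0 ≤ deriv Ψ x := hΨ.deriv_nonneg
    rw [Real.enorm_eq_ofReal_abs]
    calc _ ≤ ENNReal.ofReal (c * deriv Ψ x ^ (1 / p)) ^ p := by gcongr
      _ = _ := by
        rw [ENNReal.ofReal_mul hc, ENNReal.mul_rpow_of_nonneg _ _ hp0.le,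
          ← ENNReal.ofReal_rpow_of_nonneg hnn (by positivity), ← ENNReal.rpow_mul,
          one_div, inv_mul_cancel₀ hp0.ne', ENNReal.rpow_one]
  calc (∫⁻ x, ‖deriv f x‖ₑ ^ p) ^ (1 / p)
      ≤ (ENNReal.ofReal c ^ p * ENNReal.ofReal (β - α)) ^ (1 / p) := by
        refine ENNReal.rpow_le_rpow ((lintegral_mono_ae hpt).trans ?_) (by positivity)
        rw [lintegral_const_mul _ (measurable_deriv Ψ).ennreal_ofReal]
        gcongr
        exact lintegral_deriv_le_of_monotone hΨ hb
    _ = _ := by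
        rw [ENNReal.mul_rpow_of_nonneg _ _ (by positivity), ← ENNReal.rpow_mul, one_div,
          mul_inv_cancel₀ hp0.ne', ENNReal.rpow_one]

/-! ### Taylor jets -/

theorem eval_iterate_derivative_eq_coeff_taylor (R : ℝ[X]) (x : ℝ) (i : ℕ) :
    (derivative^[i] R).eval x = i ! * (taylor x R).coeff i := by
  rw [taylor_coeff, ← factorial_smul_hasseDeriv]
  simp

theorem taylor_taylorJet (n : ℕ) (F : ℝ → ℝ) (x : ℝ) :
    taylor x (taylorJet n F x) =
      ∑ k ∈ Finset.range (n + 1), C (iteratedDeriv k F x / (k ! : ℝ)) * X ^ k := by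
  simp [taylorJet, taylor_mul, taylor_pow]

theorem natDegree_taylorJet_lt {m : ℕ} (hm : 1 ≤ m) (F : ℝ → ℝ) (x : ℝ) :
    (taylorJet (m - 1) F x).natDegree < m := by
  refine lt_of_le_of_lt (natDegree_sum_le_of_forall_le (n := m - 1) _ _ fun k hk => ?_) (by omega)
  have := Finset.mem_range.1 hk
  refine (natDegree_C_mul_le _ _).trans ?_
  rw [natDegree_pow, natDegree_X_sub_C]
  omega

theorem eval_iterate_derivative_taylorJet {m i : ℕ} (hi : i < m) (F : ℝ → ℝ) (x : ℝ) :
    (derivative^[i] (taylorJet (m - 1) F x)).eval x = iteratedDeriv i F x := by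
  rw [eval_iterate_derivative_eq_coeff_taylor, taylor_taylorJet, finsetSum_coeff]
  simp only [coeff_C_mul_X_pow]
  rw [Finset.sum_ite_eq, if_pos (Finset.mem_range.2 (by omega))]
  exact mul_div_cancel₀ _ (by positivity)

/-- A polynomial of degree less than `m` is determined by its derivatives at one point. -/
theorem taylorJet_eq_of_eval_eq {m : ℕ} (hm : 1 ≤ m) {F : ℝ → ℝ} {x : ℝ} {R : ℝ[X]}
    (hR : R.natDegree < m) (h : ∀ i < m, iteratedDeriv i F x = (derivative^[i] R).eval x) :
    taylorJet (m - 1) F x = R := by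
  apply taylor_injective x
  ext i
  have hi : (i ! : ℝ) ≠ 0 := by positivity
  apply mul_left_cancel₀ hi
  rw [← eval_iterate_derivative_eq_coeff_taylor, ← eval_iterate_derivative_eq_coeff_taylor]
  by_cases him : i < m
  · rw [eval_iterate_derivative_taylorJet him, h i him]
  · rw [iterate_derivative_eq_zero ((natDegree_taylorJet_lt hm F x).trans_le (not_lt.1 him)),
      iterate_derivative_eq_zero (hR.trans_le (not_lt.1 him))]

/-! ### From a field of jets on the line to a Sobolev function -/

/-- The components of a field of jets on the line that is controlled by a bounded monotone
function are successive derivatives of each other. -/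
theorem hasDerivAt_of_jetClose {m : ℕ} {p c α β : ℝ} (hp : 1 < p) (hc : 0 ≤ c) {Q : ℝ → ℝ[X]}
    {Ψ : ℝ → ℝ} (hQ : ∀ x, (Q x).natDegree < m) (hΨ : Monotone Ψ)
    (hb : ∀ x, Ψ x ∈ Set.Icc α β)
    (hclose : ∀ x y, x ≤ y → JetClose m (Q x) (Q y) (c * geomIncrement p Ψ x y) x y)
    {i : ℕ} (hi : i + 1 < m) (x : ℝ) :
    HasDerivAt (fun t => (derivative^[i] (Q t)).eval t) ((derivative^[i + 1] (Q x)).eval x) x := by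
  have hαβ : α ≤ β := (hb 0).1.trans (hb 0).2
  have hp1 : 0 < 1 - 1 / p := sub_pos.2 ((div_lt_one (by linarith)).2 hp)
  have hsub : ∀ x y, (Q x - Q y).natDegree < m := fun x y =>
    (natDegree_sub_le _ _).trans_lt (max_lt (hQ x) (hQ y))
  have hgeom : ∀ s t, s ≤ t →
      geomIncrement p Ψ s t ≤ (β - α) ^ (1 / p) * (t - s) ^ (1 - 1 / p) := by
    intro s t hst
    have h1 : 0 ≤ Ψ t - Ψ s := sub_nonneg.2 (hΨ hst)
    have h2 : Ψ t - Ψ s ≤ β - α := by linarith [(hb t).2, (hb s).1]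
    have h3 := sub_nonneg.2 hst
    rw [geomIncrement]
    gcongr
  -- the component `i` differs from the polynomial `Q x` by a term of order greater than one
  set g : ℝ → ℝ := fun t => (derivative^[i] (Q t)).eval t - (derivative^[i] (Q x)).eval t with hg
  have hbound : ∀ t, |g t| ≤
      c * ((β - α) ^ (1 / p) * |t - x| ^ (1 - 1 / p)) * (2 * |t - x|) ^ (m - 1 - i) := by
    intro t
    simp only [hg]
    rw [← eval_sub, ← iterate_derivative_sub]
    rcases le_total x t with h | h
    · have h0 := sub_nonneg.2 h
      have h1 := (hclose x t h).abs_eval_le h (hsub x t) t (i := i) (by omega)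
      rw [iterate_derivative_sub, eval_sub, abs_sub_comm, ← eval_sub, ← iterate_derivative_sub]
      refine h1.trans ?_
      rw [abs_of_nonneg h0, two_mul]
      gcongr
      exact hgeom x t h
    · have h0 := sub_nonneg.2 h
      refine (hclose t x h i (by omega)).trans ?_
      rw [abs_sub_comm, abs_of_nonneg h0]
      have hd : 0 ≤ β - α := sub_nonneg.2 hαβ
      gcongr
      · exact hgeom t x h
      · linarith
  have hg0 : HasDerivAt g 0 x := by
    rw [hasDerivAt_iff_tendsto_slope]
    have hlim : Filter.Tendsto (fun t => c * ((β - α) ^ (1 / p) * |t - x| ^ (1 - 1 / p)) *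
        (2 * (2 * |t - x|) ^ (m - 2 - i))) (nhdsWithin x {x}ᶜ) (nhds 0) := by
      have hcont : Continuous fun t => c * ((β - α) ^ (1 / p) * |t - x| ^ (1 - 1 / p)) *
          (2 * (2 * |t - x|) ^ (m - 2 - i)) := by
        have : Continuous fun t : ℝ => |t - x| ^ (1 - 1 / p) :=
          (by fun_prop : Continuous fun t : ℝ => |t - x|).rpow_const fun _ => Or.inr hp1.le
        fun_prop
      have := (hcont.tendsto x).mono_left (nhdsWithin_le_nhds (s := {x}ᶜ))
      simpa only [sub_self, abs_zero, Real.zero_rpow hp1.ne', mul_zero, zero_mul] using this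
    refine squeeze_zero_norm' ?_ hlim
    filter_upwards [self_mem_nhdsWithin] with t ht
    have htx : 0 < |t - x| := abs_pos.2 (sub_ne_zero.2 ht)
    have hgx : g x = 0 := by simp [hg]
    rw [slope_def_field, hgx, sub_zero, Real.norm_eq_abs, abs_div, div_le_iff₀ htx]
    refine (hbound t).trans_eq ?_
    rw [show m - 1 - i = m - 2 - i + 1 by omega, pow_succ]
    ring
  have := hg0.add (hasDerivAt_eval_iterate_derivative (Q x) i x)
  rw [zero_add] at this
  refine this.congr_of_eventuallyEq (Filter.Eventually.of_forall fun t => ?_)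
  simp [hg]

theorem exists_contDiff_of_jetClose {m : ℕ} (hm : 1 ≤ m) {p c α β : ℝ} (hp : 1 < p)
    (hc : 0 ≤ c) {Q : ℝ → ℝ[X]} {Ψ : ℝ → ℝ} (hQ : ∀ x, (Q x).natDegree < m)
    (hΨ : Monotone Ψ) (hb : ∀ x, Ψ x ∈ Set.Icc α β)
    (hclose : ∀ x y, x ≤ y → JetClose m (Q x) (Q y) (c * geomIncrement p Ψ x y) x y) :
    ∃ F : ℝ → ℝ, ContDiff ℝ ((m - 1 : ℕ) : WithTop ℕ∞) F ∧
      (∀ x, taylorJet (m - 1) F x = Q x) ∧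
      (∀ a b, AbsolutelyContinuousOnInterval (iteratedDeriv (m - 1) F) a b) ∧
      eLpNorm (deriv (iteratedDeriv (m - 1) F)) (ENNReal.ofReal p) volume ≤
        ENNReal.ofReal c * ENNReal.ofReal (β - α) ^ (1 / p) := by
  set f : ℕ → ℝ → ℝ := fun i t => (derivative^[i] (Q t)).eval t with hf
  have hder : ∀ i, i + 1 < m → ∀ x, HasDerivAt (f i) (f (i + 1) x) x := fun i hi x =>
    hasDerivAt_of_jetClose hp hc hQ hΨ hb hclose hi x
  have hiter : ∀ i < m, iteratedDeriv i (f 0) = f i := by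
    intro i
    induction i with
    | zero => intro _; exact iteratedDeriv_zero
    | succ i ih =>
      intro hi
      rw [iteratedDeriv_succ, ih (by omega)]
      exact funext fun x => (hder i hi x).deriv
  have htop : ∀ x y, x ≤ y → |f (m - 1) x - f (m - 1) y| ≤ c * geomIncrement p Ψ x y := by
    intro x y hxy
    have h := hclose x y hxy (m - 1) (by omega)
    rw [iterate_derivative_sub, eval_sub, Nat.sub_self, pow_zero, mul_one,
      eval_iterate_derivative_pred_eq (hQ y) x y] at h
    exact h
  have hac : ∀ a b, AbsolutelyContinuousOnInterval (f (m - 1)) a b :=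
    absolutelyContinuousOnInterval_of_le_geomIncrement hp hΨ hb hc htop
  have htopc : Continuous (f (m - 1)) := by
    refine continuous_iff_continuousAt.2 fun x => ?_
    refine (hac (x - 1) (x + 1)).continuousOn.continuousAt ?_
    rw [Set.uIcc_of_le (by linarith)]
    exact Icc_mem_nhds (by linarith) (by linarith)
  refine ⟨f 0, contDiff_nat_iff_iteratedDeriv.2 ⟨fun i hi => ?_, fun i hi => ?_⟩, fun x => ?_, ?_,
    ?_⟩
  · rw [hiter i (by omega)]
    rcases hi.eq_or_lt with rfl | hlt
    · exact htopc
    · exact continuous_iff_continuousAt.2 fun x => (hder i (by omega) x).continuousAt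
  · rw [hiter i (by omega)]
    exact fun x => (hder i (by omega) x).differentiableAt
  · exact taylorJet_eq_of_eval_eq hm (hQ x) fun i hi => by rw [hiter i hi]
  · rw [hiter _ (by omega)]
    exact hac
  · rw [hiter _ (by omega)]
    exact eLpNorm_deriv_le_of_le_geomIncrement hp hΨ hb hc htop

/-! ### Weak derivatives -/

theorem locallyIntegrable_deriv_of_absolutelyContinuous {f : ℝ → ℝ}
    (hf : ∀ a b, AbsolutelyContinuousOnInterval f a b) : LocallyIntegrable (deriv f) volume := by
  intro x
  refine ⟨Set.Icc (x - 1) (x + 1), Icc_mem_nhds (by linarith) (by linarith), ?_⟩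
  exact (intervalIntegrable_iff_integrableOn_Icc_of_le (by linarith)).1
    (hf (x - 1) (x + 1)).intervalIntegrable_deriv

theorem absolutelyContinuousOnInterval_of_contDiff {f : ℝ → ℝ} (hf : ContDiff ℝ 1 f) (a b : ℝ) :
    AbsolutelyContinuousOnInterval f a b :=
  hf.contDiffOn.absolutelyContinuousOnInterval

theorem integral_mul_deriv_eq_neg_of_absolutelyContinuous {f ψ : ℝ → ℝ}
    (hf : ∀ a b, AbsolutelyContinuousOnInterval f a b) (hψ : ContDiff ℝ 1 ψ)
    (hc : HasCompactSupport ψ) : ∫ t, f t * deriv ψ t = -∫ t, deriv f t * ψ t := by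
  obtain ⟨R, hR⟩ := hc.isCompact.isBounded.subset_closedBall 0
  have hsub : tsupport ψ ⊆ Set.Ioo (-(R + 1)) (R + 1) := fun t ht => by
    have := hR ht
    rw [Metric.mem_closedBall, dist_zero_right, Real.norm_eq_abs, abs_le] at this
    constructor <;> linarith [this.1, this.2]
  have hend : ∀ t, t ∉ Set.Ioo (-(R + 1)) (R + 1) → ψ t = 0 := fun t ht =>
    image_eq_zero_of_notMem_tsupport fun h => ht (hsub h)
  have h := (hf (-(R + 1)) (R + 1)).integral_mul_deriv_eq_deriv_mul
    (absolutelyContinuousOnInterval_of_contDiff hψ (-(R + 1)) (R + 1))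
  rw [hend (R + 1) (by simp), hend (-(R + 1)) (by simp), mul_zero, mul_zero, sub_zero, zero_sub,
    intervalIntegral.integral_eq_integral_of_support_subset,
    intervalIntegral.integral_eq_integral_of_support_subset] at h
  · exact h
  · exact (Function.support_mul_subset_right _ _).trans ((subset_tsupport ψ).trans
      (hsub.trans Set.Ioo_subset_Ioc_self))
  · exact (Function.support_mul_subset_right _ _).trans (support_deriv_subset.trans
      (hsub.trans Set.Ioo_subset_Ioc_self))

theorem hasCompactSupport_iteratedDeriv {ψ : ℝ → ℝ} (hc : HasCompactSupport ψ) (k : ℕ) :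
    HasCompactSupport (iteratedDeriv k ψ) := by
  induction k with
  | zero => simpa only [iteratedDeriv_zero] using hc
  | succ k ih => rw [iteratedDeriv_succ]; exact ih.deriv

/-- A function of class `C^n` whose `n`-th derivative is absolutely continuous has the almost
everywhere derivative of the latter as its weak derivative of order `n + 1`. -/
theorem isWeakDeriv_deriv_iteratedDeriv {n : ℕ} {F : ℝ → ℝ} (hF : ContDiff ℝ (n : WithTop ℕ∞) F)
    (hac : ∀ a b, AbsolutelyContinuousOnInterval (iteratedDeriv n F) a b) :
    IsWeakDeriv (n + 1) F (deriv (iteratedDeriv n F)) := by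
  refine ⟨hF.continuous.locallyIntegrable, locallyIntegrable_deriv_of_absolutelyContinuous hac,
    fun ψ hψ hc => ?_⟩
  have hψ1 : ∀ k : ℕ, ContDiff ℝ 1 (iteratedDeriv k ψ) := fun k =>
    (iteratedDeriv_eq_iterate (n := k) (f := ψ)) ▸
      (hψ.of_le (by exact_mod_cast le_top)).iterate_deriv' 1 k
  have hstep : ∀ k ≤ n, ∫ t, F t * iteratedDeriv (n + 1) ψ t =
      (-1) ^ k * ∫ t, iteratedDeriv k F t * iteratedDeriv (n + 1 - k) ψ t := by
    intro k
    induction k with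
    | zero => intro _; simp
    | succ k ih =>
      intro hk
      have hFk : ContDiff ℝ 1 (iteratedDeriv k F) :=
        (iteratedDeriv_eq_iterate (n := k) (f := F)) ▸
          (hF.of_le (by exact_mod_cast (by omega : 1 + k ≤ n))).iterate_deriv' 1 k
      rw [ih (by omega), show n + 1 - k = n + 1 - (k + 1) + 1 by omega, iteratedDeriv_succ,
        integral_mul_deriv_eq_neg_of_absolutelyContinuous
          (absolutelyContinuousOnInterval_of_contDiff hFk) (hψ1 _)
          (hasCompactSupport_iteratedDeriv hc _), ← iteratedDeriv_succ]
      ring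
  rw [hstep n le_rfl, Nat.add_sub_cancel_left, iteratedDeriv_one,
    integral_mul_deriv_eq_neg_of_absolutelyContinuous hac
      (by simpa only [iteratedDeriv_zero] using hψ1 0) hc]
  ring

theorem IsWeakDeriv.ae_eq {k : ℕ} {F g h : ℝ → ℝ} (hg : IsWeakDeriv k F g)
    (hh : IsWeakDeriv k F h) : g =ᵐ[volume] h := by
  refine ae_eq_of_integral_contDiff_smul_eq hg.2.1 hh.2.1 fun ψ hψ hc => ?_
  have e := (hg.2.2 ψ hψ hc).symm.trans (hh.2.2 ψ hψ hc)
  have := mul_left_cancel₀ (pow_ne_zero k (by norm_num : (-1 : ℝ) ≠ 0)) e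
  simpa only [smul_eq_mul, mul_comm] using this

/-! ### The jets of a Sobolev function -/

theorem abs_sub_le_geomIncrement_integral {p : ℝ} (hp : 1 < p) {f : ℝ → ℝ}
    (hac : ∀ a b, AbsolutelyContinuousOnInterval f a b)
    (hL : MemLp (deriv f) (ENNReal.ofReal p) volume) {x y : ℝ} (hxy : x ≤ y) :
    |f x - f y| ≤ geomIncrement p (fun s => ∫ t in Set.Iic s, |deriv f t| ^ p) x y := by
  have hp0 : 0 < p := by linarith
  have hint : Integrable (fun t => |deriv f t| ^ p) volume := by
    have := hL.integrable_norm_rpow (by simpa using hp0) ENNReal.ofReal_ne_top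
    simpa only [ENNReal.toReal_ofReal hp0.le, Real.norm_eq_abs] using this
  have hpq := Real.HolderConjugate.conjExponent hp
  have hq : 1 / p.conjExponent = 1 - 1 / p := by
    have := hpq.inv_add_inv_eq_one
    simp only [one_div]; linarith
  have hH := integral_mul_norm_le_Lp_mul_Lq (μ := volume.restrict (Set.Ioc x y)) hpq
    (hL.restrict (Set.Ioc x y)) (memLp_const (1 : ℝ))
  simp only [norm_one, mul_one, Real.one_rpow, Real.norm_eq_abs, integral_const, smul_eq_mul,
    measureReal_restrict_apply MeasurableSet.univ, Set.univ_inter,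
    Real.volume_real_Ioc_of_le hxy, hq] at hH
  rw [geomIncrement, intervalIntegral.integral_Iic_sub_Iic hint.integrableOn hint.integrableOn,
    intervalIntegral.integral_of_le hxy, abs_sub_comm, ← (hac x y).integral_deriv_eq_sub,
    intervalIntegral.integral_of_le hxy]
  exact (abs_integral_le_integral_abs).trans hH

theorem jetClose_taylorJet {m : ℕ} (hm : 1 ≤ m) {F : ℝ → ℝ}
    (hF : ContDiff ℝ ((m - 1 : ℕ) : WithTop ℕ∞) F) {x y K : ℝ} (hxy : x ≤ y)
    (hK : ∀ t ∈ Set.Icc x y, |iteratedDeriv (m - 1) F t - iteratedDeriv (m - 1) F y| ≤ K) :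
    JetClose m (taylorJet (m - 1) F x) (taylorJet (m - 1) F y) K x y := by
  intro i hi
  have hdeg := natDegree_taylorJet_lt hm F y
  have key := abs_le_of_hasDerivAt_chain
    (u := fun i s => iteratedDeriv i F s - (derivative^[i] (taylorJet (m - 1) F y)).eval s)
    (n := m - 1) (a := x) (b := y) (y := y) (K := K) (η := 0) le_rfl ⟨hxy, le_rfl⟩
    (fun i hi s _ => by
      refine HasDerivAt.sub ?_ (hasDerivAt_eval_iterate_derivative _ i s)
      rw [iteratedDeriv_succ]
      exact ((contDiff_nat_iff_iteratedDeriv.1 hF).2 i hi s).hasDerivAt)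
    (fun s hs => by
      rw [eval_iterate_derivative_pred_eq hdeg s y,
        eval_iterate_derivative_taylorJet (by omega)]
      exact hK s hs)
    (fun j hj => by
      rw [eval_iterate_derivative_taylorJet (by omega), sub_self, abs_zero,
        zero_pow (by omega), mul_zero])
    (show i ≤ m - 1 by omega) (t := x) ⟨le_rfl, hxy⟩
  rw [zero_add, abs_sub_comm x y, abs_of_nonneg (sub_nonneg.2 hxy)] at key
  rw [iterate_derivative_sub, eval_sub, eval_iterate_derivative_taylorJet hi]
  exact key

theorem sum_fin_sub_telescope (n : ℕ) (a : Fin (n + 1) → ℝ) :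
    ∑ j : Fin n, (a j.succ - a j.castSucc) = a (Fin.last n) - a 0 := by
  induction n with
  | zero => simp
  | succ n ih =>
    rw [Fin.sum_univ_castSucc]
    have := ih (fun j => a j.castSucc)
    simp only [Fin.succ_castSucc, this, Fin.succ_last, Fin.castSucc_zero]
    ring

/-- A field of jets that is controlled by a bounded monotone function has finite variation: the
increments of that function telescope along a sequence. -/
theorem jetVariation_le_of_jetClose {m : ℕ} (hm : 1 ≤ m) {p α β : ℝ} (hp : 1 < p) {E : Set ℝ}
    {P : E → ℝ[X]} {Ω : ℝ → ℝ} (hΩ : Monotone Ω) (hb : ∀ x, Ω x ∈ Set.Icc α β)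
    (hclose : ∀ x y : E, x < y →
      JetClose m (P x) (P y) (geomIncrement p Ω x y) x y) :
    jetVariation m p E P ≤ m * ENNReal.ofReal (β - α) ^ (1 / p) := by
  have hp0 : 0 < p := by linarith
  have h1 : (⨆ (n : ℕ) (x : Fin (n + 2) → E) (_ : StrictMono x),
      ENNReal.ofReal (jetVariationSum m p E P n x)) ≤ m * ENNReal.ofReal (β - α) := by
    refine iSup_le fun n => iSup_le fun x => iSup_le fun hx => ?_
    rw [← ENNReal.ofReal_natCast, ← ENNReal.ofReal_mul (by positivity)]
    refine ENNReal.ofReal_le_ofReal ?_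
    calc jetVariationSum m p E P n x
        ≤ ∑ j : Fin (n + 1), m * (Ω (x j.succ) - Ω (x j.castSucc)) := by
          refine Finset.sum_le_sum fun j _ => ?_
          have hlt : (x j.castSucc : ℝ) < x j.succ := hx Fin.castSucc_lt_succ
          have hΩle := sub_nonneg.2 (hΩ hlt.le)
          have hterm : ∀ i ∈ Finset.range m,
              |(derivative^[i] (P (x j.castSucc))).eval (x j.castSucc : ℝ) -
                (derivative^[i] (P (x j.succ))).eval (x j.castSucc : ℝ)| ^ p /
                ((x j.succ : ℝ) - (x j.castSucc : ℝ)) ^ (((m : ℝ) - (i : ℝ)) * p - 1) ≤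
                Ω (x j.succ) - Ω (x j.castSucc) := fun i hi => by
            rw [rpow_div_rpow_le_iff hp (Finset.mem_range.1 hi) (abs_nonneg _)
              (sub_pos.2 hlt) hΩle, ← eval_sub, ← iterate_derivative_sub]
            exact hclose _ _ hlt i (Finset.mem_range.1 hi)
          exact (Finset.sum_le_sum hterm).trans_eq (by simp [mul_sub])
      _ = m * (Ω (x (Fin.last (n + 1))) - Ω (x 0)) := by
          rw [← Finset.mul_sum, sum_fin_sub_telescope (n + 1) fun j => Ω (x j)]
      _ ≤ m * (β - α) := by
          have h1 := (hb (x (Fin.last (n + 1)))).2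
          have h2 := (hb (x 0)).1
          gcongr
  have hm1 : (1 : ℝ≥0∞) ≤ m := by exact_mod_cast hm
  calc jetVariation m p E P ≤ (m * ENNReal.ofReal (β - α)) ^ (1 / p) :=
        ENNReal.rpow_le_rpow h1 (by positivity)
    _ = (m : ℝ≥0∞) ^ (1 / p) * ENNReal.ofReal (β - α) ^ (1 / p) :=
        ENNReal.mul_rpow_of_nonneg _ _ (by positivity)
    _ ≤ _ := by
        gcongr
        calc (m : ℝ≥0∞) ^ (1 / p) ≤ (m : ℝ≥0∞) ^ (1 : ℝ) :=
              ENNReal.rpow_le_rpow_of_exponent_le hm1 ((div_le_one hp0).2 hp.le)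
          _ = m := ENNReal.rpow_one _

/-- The variation of the field of Taylor polynomials of a Sobolev function is at most `m` times
the norm of its weak derivative; the controlling function is `x ↦ ∫_{-∞}^x |F⁽ᵐ⁾|^p`. -/
theorem jetVariation_le_eLpNorm {m : ℕ} (hm : 1 ≤ m) {p : ℝ} (hp : 1 < p) {E : Set ℝ}
    {P : E → ℝ[X]} {F g : ℝ → ℝ} (hF : MemSobolevL m p F)
    (hP : ∀ x : E, taylorJet (m - 1) F (x : ℝ) = P x) (hg : IsWeakDeriv m F g) :
    jetVariation m p E P ≤ m * eLpNorm g (ENNReal.ofReal p) volume := by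
  have hp0 : 0 < p := by linarith
  set f := iteratedDeriv (m - 1) F with hf
  have hac : ∀ a b, AbsolutelyContinuousOnInterval f a b := hF.absolutelyContinuous
  have hwd : IsWeakDeriv m F (deriv f) := by
    have := isWeakDeriv_deriv_iteratedDeriv hF.contDiff hF.absolutelyContinuous
    rwa [Nat.sub_add_cancel hm] at this
  have hL : MemLp (deriv f) (ENNReal.ofReal p) volume := by
    obtain ⟨g', hg', hg'L⟩ := hF.exists_weakDeriv
    exact hg'L.ae_eq (hg'.ae_eq hwd)
  have hint : Integrable (fun t => |deriv f t| ^ p) volume := by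
    have := hL.integrable_norm_rpow (by simpa using hp0) ENNReal.ofReal_ne_top
    simpa only [ENNReal.toReal_ofReal hp0.le, Real.norm_eq_abs] using this
  have hnn : ∀ t, 0 ≤ |deriv f t| ^ p := fun t => Real.rpow_nonneg (abs_nonneg _) _
  set Ω : ℝ → ℝ := fun s => ∫ t in Set.Iic s, |deriv f t| ^ p with hΩdef
  have hΩ : Monotone Ω := fun s s' h => setIntegral_mono_set hint.integrableOn
    (Filter.Eventually.of_forall hnn) (Set.Iic_subset_Iic.2 h).eventuallyLE
  have hb : ∀ s, Ω s ∈ Set.Icc 0 (∫ t, |deriv f t| ^ p) := fun s =>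
    ⟨integral_nonneg hnn, setIntegral_le_integral hint (Filter.Eventually.of_forall hnn)⟩
  have hnorm : eLpNorm g (ENNReal.ofReal p) volume =
      ENNReal.ofReal (∫ t, |deriv f t| ^ p) ^ (1 / p) := by
    rw [eLpNorm_congr_ae (hg.ae_eq hwd), hL.eLpNorm_eq_integral_rpow_norm (by simpa using hp0)
      ENNReal.ofReal_ne_top, ENNReal.toReal_ofReal hp0.le,
      ENNReal.ofReal_rpow_of_nonneg (integral_nonneg hnn) (by positivity), one_div]
    rfl
  have := jetVariation_le_of_jetClose (P := P) hm hp hΩ hb fun x y hxy => by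
    rw [← hP x, ← hP y]
    refine jetClose_taylorJet hm hF.contDiff hxy.le fun t ht => ?_
    refine (abs_sub_le_geomIncrement_integral hp hac hL ht.2).trans ?_
    -- the geometric mean increases with the interval
    have h1 := geomIncrement_add_le hp ht.1 ht.2 (hΩ ht.1) (hΩ ht.2)
    have h2 := geomIncrement_nonneg (p := p) (hΩ ht.1) ht.1
    linarith
  rwa [sub_zero, ← hnorm] at this

/-! ### The controlling function of a field of finite variation -/

/-- The summand of the variation that belongs to two consecutive points. -/
noncomputable def jetPairSum (m : ℕ) (p : ℝ) {E : Set ℝ} (P : E → ℝ[X]) (a b : E) : ℝ :=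
  ∑ i ∈ Finset.range m,
    |(derivative^[i] (P a)).eval (a : ℝ) - (derivative^[i] (P b)).eval (a : ℝ)| ^ p /
      ((b : ℝ) - (a : ℝ)) ^ (((m : ℝ) - (i : ℝ)) * p - 1)

theorem jetPairSum_term_nonneg {p : ℝ} {E : Set ℝ} (P : E → ℝ[X]) {a b : E} (hab : a < b)
    (m i : ℕ) : 0 ≤
      |(derivative^[i] (P a)).eval (a : ℝ) - (derivative^[i] (P b)).eval (a : ℝ)| ^ p /
        ((b : ℝ) - (a : ℝ)) ^ (((m : ℝ) - (i : ℝ)) * p - 1) := by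
  have hab' : (0 : ℝ) < b - a := sub_pos.2 hab
  positivity

theorem jetPairSum_nonneg (m : ℕ) (p : ℝ) {E : Set ℝ} (P : E → ℝ[X]) {a b : E} (hab : a < b) :
    0 ≤ jetPairSum m p P a b :=
  Finset.sum_nonneg fun i _ => jetPairSum_term_nonneg P hab m i

/-- The supremum of the variation sums over the finite increasing sequences in `E` that end at
`e`; the one-point sequence contributes `0`. -/
noncomputable def jetVariationUpTo (m : ℕ) (p : ℝ) {E : Set ℝ} (P : E → ℝ[X]) (e : E) : ℝ≥0∞ :=
  ⨆ (n : ℕ) (x : Fin (n + 1) → E) (_ : StrictMono x) (_ : x (Fin.last n) = e),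
    ENNReal.ofReal (∑ j : Fin n, jetPairSum m p P (x j.castSucc) (x j.succ))

theorem jetVariationUpTo_le (m : ℕ) (p : ℝ) {E : Set ℝ} (P : E → ℝ[X]) (e : E) :
    jetVariationUpTo m p P e ≤ ⨆ (n : ℕ) (x : Fin (n + 2) → E) (_ : StrictMono x),
      ENNReal.ofReal (jetVariationSum m p E P n x) := by
  refine iSup_le fun n => iSup_le fun x => iSup_le fun hx => iSup_le fun _ => ?_
  cases n with
  | zero => simp
  | succ n =>
    exact le_iSup_of_le n (le_iSup_of_le x (le_iSup_of_le (i := hx) le_rfl))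

theorem jetVariationUpTo_add_le (m : ℕ) (p : ℝ) {E : Set ℝ} (P : E → ℝ[X]) {a b : E}
    (hab : a < b) :
    jetVariationUpTo m p P a + ENNReal.ofReal (jetPairSum m p P a b) ≤
      jetVariationUpTo m p P b := by
  -- a sequence that ends at `a` is continued by the point `b`
  have hext : ∀ (n : ℕ) (x : Fin (n + 1) → E), StrictMono x → x (Fin.last n) = a →
      ENNReal.ofReal (∑ j : Fin n, jetPairSum m p P (x j.castSucc) (x j.succ)) +
        ENNReal.ofReal (jetPairSum m p P a b) ≤ jetVariationUpTo m p P b := by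
    intro n x hx hxa
    set y : Fin (n + 2) → E := Fin.snoc (α := fun _ => E) x b with hy
    have hyc : ∀ j : Fin (n + 1), y j.castSucc = x j := fun j => by
      rw [hy, Fin.snoc_castSucc]
    have hyl : y (Fin.last (n + 1)) = b := by rw [hy, Fin.snoc_last]
    have hymono : StrictMono y := by
      refine Fin.strictMono_iff_lt_succ.2 fun j => ?_
      induction j using Fin.lastCases with
      | last => rw [hyc, Fin.succ_last, hyl, hxa]; exact hab
      | cast k => rw [hyc, Fin.succ_castSucc, hyc]; exact hx Fin.castSucc_lt_succ
    rw [← ENNReal.ofReal_add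
      (Finset.sum_nonneg fun j _ => jetPairSum_nonneg m p P (hx Fin.castSucc_lt_succ))
      (jetPairSum_nonneg m p P hab)]
    refine le_iSup_of_le (n + 1) (le_iSup_of_le y (le_iSup_of_le (i := hymono)
      (le_iSup_of_le (i := hyl) (ENNReal.ofReal_le_ofReal (le_of_eq ?_)))))
    rw [Fin.sum_univ_castSucc (n := n)]
    simp only [hyc, Fin.succ_castSucc, Fin.succ_last, hyl, hxa]
  have hle : ENNReal.ofReal (jetPairSum m p P a b) ≤ jetVariationUpTo m p P b := by
    have := hext 0 (fun _ => a) (fun i j h => absurd h (by omega)) rfl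
    simpa using this
  refine add_le_of_le_tsub_right_of_le hle ?_
  exact iSup_le fun n => iSup_le fun x => iSup_le fun hx => iSup_le fun hxa =>
    ENNReal.le_sub_of_add_le_right ENNReal.ofReal_ne_top (hext n x hx hxa)

theorem jetClose_of_jetPairSum_le {m : ℕ} {p : ℝ} (hp : 1 < p) {E : Set ℝ} {P : E → ℝ[X]}
    {Ω : ℝ → ℝ} {a b : E} (hab : a < b) (h : jetPairSum m p P a b ≤ Ω b - Ω a) :
    JetClose m (P a) (P b) (geomIncrement p Ω a b) a b := by
  intro i hi
  have hab' : (0 : ℝ) < b - a := sub_pos.2 hab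
  have hterm := (Finset.single_le_sum (fun i _ => jetPairSum_term_nonneg (p := p) P hab m i)
    (Finset.mem_range.2 hi)).trans h
  rw [iterate_derivative_sub, eval_sub]
  exact (rpow_div_rpow_le_iff hp hi (abs_nonneg _) hab'
    ((jetPairSum_nonneg m p P hab).trans h)).1 hterm

/-- A field of finite variation is the field of jets of a Sobolev function whose seminorm is
bounded by a multiple of the variation. -/
theorem exists_memSobolevL_of_jetVariation_lt_top {m : ℕ} (hm : 1 ≤ m) :
    ∃ c : ℝ, ∀ (p : ℝ), 1 < p → ∀ (E : Set ℝ), IsClosed E → ∀ (P : E → ℝ[X]),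
      (∀ x : E, (P x).natDegree ≤ m - 1) → jetVariation m p E P < ⊤ →
      ∃ F : ℝ → ℝ, MemSobolevL m p F ∧ (∀ x : E, taylorJet (m - 1) F (x : ℝ) = P x) ∧
        sobolevLSeminorm m p F ≤ ENNReal.ofReal c * jetVariation m p E P := by
  obtain ⟨c, hc1, hc⟩ := exists_jet_field_extension hm
  refine ⟨c, fun p hp E hE P hdeg hfin => ?_⟩
  have hc0 : 0 ≤ c := by linarith
  have hp0 : 0 < p := by linarith
  set S : ℝ≥0∞ := ⨆ (n : ℕ) (x : Fin (n + 2) → E) (_ : StrictMono x),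
    ENNReal.ofReal (jetVariationSum m p E P n x) with hS
  have hSV : jetVariation m p E P = S ^ (1 / p) := rfl
  have hStop : S ≠ ⊤ := by
    rw [hSV, ENNReal.rpow_lt_top_iff_of_pos (by positivity)] at hfin
    exact hfin.ne
  obtain ⟨Q, Ψ, hQ, hQP, hΨ, hb, hclose⟩ : ∃ (Q : ℝ → ℝ[X]) (Ψ : ℝ → ℝ),
      (∀ x, (Q x).natDegree < m) ∧ (∀ x : E, Q x = P x) ∧ Monotone Ψ ∧
      (∀ x, Ψ x ∈ Set.Icc 0 S.toReal) ∧
      ∀ x y, x ≤ y → JetClose m (Q x) (Q y) (c * geomIncrement p Ψ x y) x y := by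
    rcases E.eq_empty_or_nonempty with rfl | hne
    · refine ⟨0, 0, fun x => by simpa using (by omega : 0 < m), fun x => x.2.elim,
        monotone_const, fun x => ⟨le_rfl, ENNReal.toReal_nonneg⟩, fun x y hxy => ?_⟩
      exact JetClose.refl m 0 (mul_nonneg hc0 (geomIncrement_nonneg le_rfl hxy)) hxy
    · set W : E → ℝ := fun e => (jetVariationUpTo m p P e).toReal with hW
      have hWtop : ∀ e : E, jetVariationUpTo m p P e ≠ ⊤ := fun e =>
        ((jetVariationUpTo_le m p P e).trans_lt hStop.lt_top).ne
      have hinc : ∀ a b : E, a < b → jetPairSum m p P a b ≤ W b - W a := by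
        intro a b hab
        have h := ENNReal.toReal_mono (hWtop b) (jetVariationUpTo_add_le m p P hab)
        rw [ENNReal.toReal_add (hWtop a) ENNReal.ofReal_ne_top,
          ENNReal.toReal_ofReal (jetPairSum_nonneg m p P hab)] at h
        simp only [hW]
        linarith
      have hext : ∀ {T : Type} (u : E → T) (v : ℝ → T) (e : E),
          Function.extend Subtype.val u v (e : ℝ) = u e := fun u v e =>
        Subtype.val_injective.extend_apply u v e
      obtain ⟨Q, Ψ, h1, h2, h3, h4, h5⟩ := hc p hp E hE hne (Function.extend Subtype.val P 0)
        (Function.extend Subtype.val W 0) 0 S.toReal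
        (fun x hx => by
          have := hdeg ⟨x, hx⟩
          rw [hext P 0 ⟨x, hx⟩]
          omega)
        (fun x hx y hy hxy => by
          rw [hext W 0 ⟨x, hx⟩, hext W 0 ⟨y, hy⟩]
          rcases hxy.eq_or_lt with rfl | hlt
          · exact le_rfl
          · have hlt' : (⟨x, hx⟩ : E) < ⟨y, hy⟩ := hlt
            have := (jetPairSum_nonneg m p P hlt').trans (hinc _ _ hlt')
            linarith)
        (fun x hx => by
          rw [hext W 0 ⟨x, hx⟩]
          exact ⟨ENNReal.toReal_nonneg, ENNReal.toReal_mono hStop (jetVariationUpTo_le m p P _)⟩)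
        (fun x hx y hy hxy => by
          have hlt : (⟨x, hx⟩ : E) < ⟨y, hy⟩ := hxy
          rw [hext P 0 ⟨x, hx⟩, hext P 0 ⟨y, hy⟩]
          refine jetClose_of_jetPairSum_le hp hlt ?_
          rw [hext W 0 ⟨x, hx⟩, hext W 0 ⟨y, hy⟩]
          exact hinc _ _ hlt)
      exact ⟨Q, Ψ, h1, fun x => (h2 x x.2).trans (hext P 0 x), h3, h4, h5⟩
  obtain ⟨F, hF, hjet, hac, hnorm⟩ := exists_contDiff_of_jetClose hm hp hc0 hQ hΨ hb hclose
  rw [sub_zero, ENNReal.ofReal_toReal hStop, ← hSV] at hnorm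
  have hwd : IsWeakDeriv m F (deriv (iteratedDeriv (m - 1) F)) := by
    have := isWeakDeriv_deriv_iteratedDeriv hF hac
    rwa [Nat.sub_add_cancel hm] at this
  refine ⟨F, ⟨hF, hac, _, hwd, (measurable_deriv _).aestronglyMeasurable,
    hnorm.trans_lt (ENNReal.mul_lt_top ENNReal.ofReal_lt_top hfin)⟩,
    fun x => (hjet x).trans (hQP x), ?_⟩
  exact (iInf₂_le _ hwd).trans hnorm

theorem theorem4p1 (m : ℕ) (hm : 1 ≤ m) :
    ∃ C : ℝ≥0, 1 ≤ C ∧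
      ∀ (p : ℝ), 1 < p →
      ∀ (E : Set ℝ), IsClosed E →
      ∀ (P : E → ℝ[X]), (∀ x : E, (P x).natDegree ≤ m - 1) →
        ((∃ F : ℝ → ℝ, ContDiff ℝ ((m - 1 : ℕ) : WithTop ℕ∞) F ∧ MemSobolevL m p F ∧
            ∀ x : E, taylorJet (m - 1) F (x : ℝ) = P x) ↔
          jetVariation m p E P < ⊤) ∧
        jetNorm m p E P ≤ (C : ℝ≥0∞) * jetVariation m p E P ∧
        jetVariation m p E P ≤ (C : ℝ≥0∞) * jetNorm m p E P := by
  obtain ⟨c, hc⟩ := exists_memSobolevL_of_jetVariation_lt_top hm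
  have hm1 : (1 : ℝ≥0) ≤ m := by exact_mod_cast hm
  refine ⟨max m c.toNNReal, le_max_of_le_left hm1, fun p hp E hE P hdeg => ⟨⟨?_, ?_⟩, ?_, ?_⟩⟩
  · rintro ⟨F, -, hF, hP⟩
    obtain ⟨g, hg, hgL⟩ := hF.exists_weakDeriv
    exact (jetVariation_le_eLpNorm hm hp hF hP hg).trans_lt
      (ENNReal.mul_lt_top (ENNReal.natCast_lt_top m) hgL.2)
  · intro hfin
    obtain ⟨F, hF, hP, -⟩ := hc p hp E hE P hdeg hfin
    exact ⟨F, hF.contDiff, hF, hP⟩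
  · rcases eq_or_ne (jetVariation m p E P) ⊤ with htop | hfin
    · have hC : ((max (m : ℝ≥0) c.toNNReal : ℝ≥0) : ℝ≥0∞) ≠ 0 :=
        ENNReal.coe_ne_zero.2 (lt_of_lt_of_le one_pos (le_max_of_le_left hm1)).ne'
      rw [htop, ENNReal.mul_top hC]
      exact le_top
    · obtain ⟨F, hF, hP, hnorm⟩ := hc p hp E hE P hdeg hfin.lt_top
      refine (iInf_le_of_le F (iInf₂_le_of_le hF hP hnorm)).trans ?_
      gcongr
      exact ENNReal.coe_le_coe.2 (le_max_right _ _)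
  · have hne : ((max (m : ℝ≥0) c.toNNReal : ℝ≥0) : ℝ≥0∞) ≠ 0 :=
      ENNReal.coe_ne_zero.2 (lt_of_lt_of_le one_pos (le_max_of_le_left hm1)).ne'
    rw [mul_comm, ← ENNReal.div_le_iff_le_mul (Or.inl hne) (Or.inl ENNReal.coe_ne_top)]
    refine le_iInf fun F => le_iInf fun hF => le_iInf fun hP => le_iInf₂ fun g hg => ?_
    rw [ENNReal.div_le_iff_le_mul (Or.inl hne) (Or.inl ENNReal.coe_ne_top), mul_comm]
    refine (jetVariation_le_eLpNorm hm hp hF hP hg).trans ?_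
    gcongr
    exact_mod_cast ENNReal.coe_le_coe.2 (le_max_left (m : ℝ≥0) c.toNNReal)
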